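/- Let $(M,g)$ be a compact 2-dimensional smooth Riemannian manifold (without boundary) whose sectional curvature is identically zero, and let $\mathcal F$ be a smooth 1-dimensional foliation of $M$. Denote by $\mathcal F$ also its tangent distribution and by $\mathcal F^{\perp}$ the $g$-orthogonal distribution. Assume that $\mathcal F$ is a Riemannian foliation, that is, $$(\mathcal L_U g)(X,Y)=U\,g(X,Y)-g([U,X],Y)-g(X,[U,Y])=0$$ for all local smooth vector fields $U$ tangent to $\mathcal F$ and $X,Y$ orthogonal to $\mathcal F$. Let $f:M\to(0,\infty)$ be a constant function, and let $g_f$ be the warped Riemannian metric on $M$, defined by $g_f(v,w)=f^2g(v,w)$ if $v$ and $w$ are both tangent to $\mathcal F$, and $g_f(v,w)=g(v,w)$ if at least one of $v,w$ is $g$-orthogonal to $\mathcal F$. Then the sectional curvature of $(M,g_f)$ is constant, equal to zero. -/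

import Mathlib

open Bundle Topology
open scoped Manifold ContDiff

set_option linter.unusedSectionVars false

noncomputable section
namespace WarpedFoliation

variable {E : Type*} [NormedAddCommGroup E] [NormedSpace ℝ E]
  {M : Type*} [TopologicalSpace M] [ChartedSpace E M] [IsManifold 𝓘(ℝ, E) ∞ M]

variable (E M) in
/-- Smooth Riemannian metrics on `M`. -/
abbrev Metric : Type _ :=
  ContMDiffRiemannianMetric 𝓘(ℝ, E) ∞ E (fun x : M ↦ TangentSpace 𝓘(ℝ, E) x)

variable (E M) in
/-- Vector fields on `M` (without any regularity). -/
abbrev VField : Type _ := ∀ x : M, TangentSpace 𝓘(ℝ, E) x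

theorem mdiffAt_inner (g : Metric E M) {x : M} {Y Z : VField E M}
    (hY : MDiffAt (T% Y) x) (hZ : MDiffAt (T% Z) x) :
    MDiffAt (fun y ↦ g.inner y (Y y) (Z y)) x := by
  have h : MDifferentiableAt 𝓘(ℝ, E) (𝓘(ℝ, E).prod 𝓘(ℝ, ℝ))
      (fun y ↦ TotalSpace.mk' ℝ (E := Bundle.Trivial M ℝ) y (g.inner y (Y y) (Z y))) x :=
    MDifferentiableAt.clm_bundle_apply₂ (F₁ := E) (F₂ := E)
      ((g.contMDiff.contMDiffAt (x := x)).mdifferentiableAt (by simp)) hY hZ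
  simp only [mdifferentiableAt_totalSpace] at h
  exact h.2

/-! ### The Levi-Civita connection -/

/-- Half of the right-hand side of the Koszul formula. -/
def koszul (g : Metric E M) (X Y Z : VField E M) (x : M) : ℝ :=
  (1 / 2 : ℝ) *
    (mvfderiv 𝓘(ℝ, E) (fun y ↦ g.inner y (Y y) (Z y)) x (X x)
      + mvfderiv 𝓘(ℝ, E) (fun y ↦ g.inner y (Z y) (X y)) x (Y x)
      - mvfderiv 𝓘(ℝ, E) (fun y ↦ g.inner y (X y) (Y y)) x (Z x)
      + g.inner x (VectorField.mlieBracket 𝓘(ℝ, E) X Y x) (Z x)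
      - g.inner x (VectorField.mlieBracket 𝓘(ℝ, E) Y Z x) (X x)
      + g.inner x (VectorField.mlieBracket 𝓘(ℝ, E) Z X x) (Y x))

variable [FiniteDimensional ℝ E]

theorem koszul_tensorial_left (g : Metric E M) {x : M} {Y Z : VField E M}
    (hY : MDiffAt (T% Y) x) (hZ : MDiffAt (T% Z) x) :
    TensorialAt 𝓘(ℝ, E) E (fun X ↦ koszul g X Y Z x) x where
  smul {f X} hf hX := by
    have e1 : (fun y ↦ g.inner y (Z y) ((f • X) y)) = fun y ↦ f y * g.inner y (Z y) (X y) := by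
      ext y; simp
    have e2 : (fun y ↦ g.inner y ((f • X) y) (Y y)) = fun y ↦ f y * g.inner y (X y) (Y y) := by
      ext y; simp
    simp only [koszul, e1, e2, mvfderiv_fun_mul hf (mdiffAt_inner g hZ hX),
      mvfderiv_fun_mul hf (mdiffAt_inner g hX hY), VectorField.mlieBracket_smul_left hf hX,
      VectorField.mlieBracket_smul_right hf hX]
    simp [g.symm x (X x)]
    ring
  add {X X'} hX hX' := by
    have e1 : (fun y ↦ g.inner y (Z y) ((X + X') y)) =
        fun y ↦ g.inner y (Z y) (X y) + g.inner y (Z y) (X' y) := by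
      ext y; simp
    have e2 : (fun y ↦ g.inner y ((X + X') y) (Y y)) =
        fun y ↦ g.inner y (X y) (Y y) + g.inner y (X' y) (Y y) := by
      ext y; simp
    simp only [koszul, e1, e2, mvfderiv_fun_add (mdiffAt_inner g hZ hX) (mdiffAt_inner g hZ hX'),
      mvfderiv_fun_add (mdiffAt_inner g hX hY) (mdiffAt_inner g hX' hY),
      VectorField.mlieBracket_add_left hX hX', VectorField.mlieBracket_add_right hX hX']
    simp
    ring

theorem koszul_tensorial_right (g : Metric E M) {x : M} {X Y : VField E M}
    (hX : MDiffAt (T% X) x) (hY : MDiffAt (T% Y) x) :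
    TensorialAt 𝓘(ℝ, E) E (fun Z ↦ koszul g X Y Z x) x where
  smul {f Z} hf hZ := by
    have e1 : (fun y ↦ g.inner y ((f • Z) y) (X y)) = fun y ↦ f y * g.inner y (Z y) (X y) := by
      ext y; simp
    have e2 : (fun y ↦ g.inner y (Y y) ((f • Z) y)) = fun y ↦ f y * g.inner y (Y y) (Z y) := by
      ext y; simp
    simp only [koszul, e1, e2, mvfderiv_fun_mul hf (mdiffAt_inner g hZ hX),
      mvfderiv_fun_mul hf (mdiffAt_inner g hY hZ), VectorField.mlieBracket_smul_left hf hZ,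
      VectorField.mlieBracket_smul_right hf hZ]
    simp [g.symm x (Z x)]
    ring
  add {Z Z'} hZ hZ' := by
    have e1 : (fun y ↦ g.inner y ((Z + Z') y) (X y)) =
        fun y ↦ g.inner y (Z y) (X y) + g.inner y (Z' y) (X y) := by
      ext y; simp
    have e2 : (fun y ↦ g.inner y (Y y) ((Z + Z') y)) =
        fun y ↦ g.inner y (Y y) (Z y) + g.inner y (Y y) (Z' y) := by
      ext y; simp
    simp only [koszul, e1, e2, mvfderiv_fun_add (mdiffAt_inner g hZ hX) (mdiffAt_inner g hZ' hX),
      mvfderiv_fun_add (mdiffAt_inner g hY hZ) (mdiffAt_inner g hY hZ'),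
      VectorField.mlieBracket_add_left hZ hZ', VectorField.mlieBracket_add_right hZ hZ']
    simp
    ring

theorem koszul_add (g : Metric E M) {x : M} {X Y Y' Z : VField E M}
    (hX : MDiffAt (T% X) x) (hY : MDiffAt (T% Y) x) (hY' : MDiffAt (T% Y') x)
    (hZ : MDiffAt (T% Z) x) :
    koszul g X (Y + Y') Z x = koszul g X Y Z x + koszul g X Y' Z x := by
  have e1 : (fun y ↦ g.inner y ((Y + Y') y) (Z y)) =
      fun y ↦ g.inner y (Y y) (Z y) + g.inner y (Y' y) (Z y) := by
    ext y; simp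
  have e2 : (fun y ↦ g.inner y (X y) ((Y + Y') y)) =
      fun y ↦ g.inner y (X y) (Y y) + g.inner y (X y) (Y' y) := by
    ext y; simp
  simp only [koszul, e1, e2, mvfderiv_fun_add (mdiffAt_inner g hY hZ) (mdiffAt_inner g hY' hZ),
    mvfderiv_fun_add (mdiffAt_inner g hX hY) (mdiffAt_inner g hX hY'),
    VectorField.mlieBracket_add_left hY hY', VectorField.mlieBracket_add_right hY hY']
  simp
  ring

theorem koszul_leibniz (g : Metric E M) {x : M} {X Y Z : VField E M} {f : M → ℝ}
    (hX : MDiffAt (T% X) x) (hY : MDiffAt (T% Y) x) (hf : MDiffAt f x)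
    (hZ : MDiffAt (T% Z) x) :
    koszul g X (f • Y) Z x = f x * koszul g X Y Z x
      + mvfderiv 𝓘(ℝ, E) f x (X x) * g.inner x (Y x) (Z x) := by
  have e1 : (fun y ↦ g.inner y ((f • Y) y) (Z y)) = fun y ↦ f y * g.inner y (Y y) (Z y) := by
    ext y; simp
  have e2 : (fun y ↦ g.inner y (X y) ((f • Y) y)) = fun y ↦ f y * g.inner y (X y) (Y y) := by
    ext y; simp
  simp only [koszul, e1, e2, mvfderiv_fun_mul hf (mdiffAt_inner g hY hZ),
    mvfderiv_fun_mul hf (mdiffAt_inner g hX hY), VectorField.mlieBracket_smul_left hf hY,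
    VectorField.mlieBracket_smul_right hf hY]
  simp [g.symm x (Y x)]
  ring

theorem inner_nondegenerate (g : Metric E M) {x : M} {v w : TangentSpace 𝓘(ℝ, E) x}
    (h : ∀ u, g.inner x v u = g.inner x w u) : v = w := by
  by_contra hne
  have h1 := g.pos x (v - w) (sub_ne_zero.2 hne)
  have h2 : g.inner x (v - w) (v - w) = 0 := by
    rw [map_sub (g.inner x), sub_apply, h, sub_self]
  rw [h2] at h1
  exact lt_irrefl _ h1

theorem exists_koszul_endomorphism (g : Metric E M) {x : M} {Y : VField E M}
    (hY : MDiffAt (T% Y) x) :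
    ∃ A : TangentSpace 𝓘(ℝ, E) x →L[ℝ] TangentSpace 𝓘(ℝ, E) x,
      ∀ X Z : VField E M, MDiffAt (T% X) x → MDiffAt (T% Z) x →
        g.inner x (A (X x)) (Z x) = koszul g X Y Z x := by
  have hfd : FiniteDimensional ℝ (TangentSpace 𝓘(ℝ, E) x) :=
    inferInstanceAs (FiniteDimensional ℝ E)
  have ht2 : T2Space (TangentSpace 𝓘(ℝ, E) x) := inferInstanceAs (T2Space E)
  let B := TensorialAt.mkHom₂ (I := 𝓘(ℝ, E)) (F := E) (F' := E)
    (fun X Z ↦ koszul g X Y Z x) x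
    (fun Z hZ ↦ koszul_tensorial_left g hY hZ) (fun X hX ↦ koszul_tensorial_right g hX hY)
  let G : TangentSpace 𝓘(ℝ, E) x →ₗ[ℝ] Module.Dual ℝ (TangentSpace 𝓘(ℝ, E) x) :=
    ContinuousLinearMap.coeLM ℝ ∘ₗ (g.inner x : _ →ₗ[ℝ] _)
  have hG : Function.Injective G := fun v w h ↦
    inner_nondegenerate g fun u ↦ LinearMap.congr_fun h u
  let e := LinearEquiv.ofInjectiveOfFinrankEq G hG (Subspace.dual_finrank_eq).symm
  let B' : TangentSpace 𝓘(ℝ, E) x →ₗ[ℝ] Module.Dual ℝ (TangentSpace 𝓘(ℝ, E) x) :=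
    ContinuousLinearMap.coeLM ℝ ∘ₗ (B : _ →ₗ[ℝ] _)
  refine ⟨LinearMap.toContinuousLinearMap (e.symm.toLinearMap ∘ₗ B'), fun X Z hX hZ ↦ ?_⟩
  have h1 := TensorialAt.mkHom₂_apply (I := 𝓘(ℝ, E)) (F := E) (F' := E)
    (Φ := fun X Z ↦ koszul g X Y Z x) (x := x)
    (fun Z hZ ↦ koszul_tensorial_left g hY hZ) (fun X hX ↦ koszul_tensorial_right g hX hY) hX hZ
  have h2 : G (e.symm (B' (X x))) = B' (X x) := e.apply_symm_apply (B' (X x))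
  exact (LinearMap.congr_fun h2 (Z x)).trans h1

open Classical in
/-- The endomorphism `v ↦ ∇_v Y` of the tangent space at `x` given by the Koszul formula. -/
def koszulCov (g : Metric E M) (Y : VField E M) (x : M) :
    TangentSpace 𝓘(ℝ, E) x →L[ℝ] TangentSpace 𝓘(ℝ, E) x :=
  if hY : MDiffAt (T% Y) x then (exists_koszul_endomorphism g hY).choose else 0

theorem inner_koszulCov (g : Metric E M) {x : M} {X Y Z : VField E M}
    (hX : MDiffAt (T% X) x) (hY : MDiffAt (T% Y) x) (hZ : MDiffAt (T% Z) x) :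
    g.inner x (koszulCov g Y x (X x)) (Z x) = koszul g X Y Z x := by
  rw [koszulCov, dif_pos hY]
  exact (exists_koszul_endomorphism g hY).choose_spec X Z hX hZ

theorem inner_koszulCov' (g : Metric E M) {x : M} {Y : VField E M} (hY : MDiffAt (T% Y) x)
    (v u : TangentSpace 𝓘(ℝ, E) x) :
    g.inner x (koszulCov g Y x v) u =
      koszul g (FiberBundle.extend E v) Y (FiberBundle.extend E u) x := by
  have h := inner_koszulCov g (FiberBundle.mdifferentiableAt_extend 𝓘(ℝ, E) E v) hY
    (FiberBundle.mdifferentiableAt_extend 𝓘(ℝ, E) E u)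
  simpa using h

/-- The Levi-Civita connection of a Riemannian metric, given by the Koszul formula (and by `0` on
vector fields that are not differentiable). The next two theorems show that it is torsion-free and
metric, which determines it on differentiable vector fields. -/
def leviCivita (g : Metric E M) :
    CovariantDerivative 𝓘(ℝ, E) E (TangentSpace 𝓘(ℝ, E) : M → Type _) where
  toFun := koszulCov g
  isCovariantDerivativeOnUniv :=
    { add := by
        intro Y Y' x hY hY' _
        ext v
        refine inner_nondegenerate g fun u ↦ ?_
        have hv := FiberBundle.mdifferentiableAt_extend 𝓘(ℝ, E) E v
        have hu := FiberBundle.mdifferentiableAt_extend 𝓘(ℝ, E) E u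
        rw [inner_koszulCov' g (mdifferentiableAt_add_section hY hY'), koszul_add g hv hY hY' hu]
        simp [inner_koszulCov' g hY, inner_koszulCov' g hY']
      leibniz := by
        intro Y f x hY hf _
        ext v
        refine inner_nondegenerate g fun u ↦ ?_
        have hv := FiberBundle.mdifferentiableAt_extend 𝓘(ℝ, E) E v
        have hu := FiberBundle.mdifferentiableAt_extend 𝓘(ℝ, E) E u
        rw [inner_koszulCov' g (hf.smul_section hY), koszul_leibniz g hv hY hf hu]
        simp [inner_koszulCov' g hY] }

theorem leviCivita_torsion (g : Metric E M) : (leviCivita g).torsion = 0 := by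
  rw [CovariantDerivative.torsion_eq_zero_iff]
  intro X Y x hX hY
  refine inner_nondegenerate g fun u ↦ ?_
  have hu := FiberBundle.mdifferentiableAt_extend 𝓘(ℝ, E) E u
  have h1 := inner_koszulCov g hX hY hu
  have h2 := inner_koszulCov g hY hX hu
  simp only [FiberBundle.extend_apply_self] at h1 h2
  have e1 : leviCivita g Y x (X x) = koszulCov g Y x (X x) := rfl
  have e2 : leviCivita g X x (Y x) = koszulCov g X x (Y x) := rfl
  have s1 : (fun y ↦ g.inner y (Y y) (FiberBundle.extend E u y)) =
      fun y ↦ g.inner y (FiberBundle.extend E u y) (Y y) := funext fun y ↦ g.symm _ _ _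
  have s2 : (fun y ↦ g.inner y (X y) (FiberBundle.extend E u y)) =
      fun y ↦ g.inner y (FiberBundle.extend E u y) (X y) := funext fun y ↦ g.symm _ _ _
  have s3 : (fun y ↦ g.inner y (Y y) (X y)) =
      fun y ↦ g.inner y (X y) (Y y) := funext fun y ↦ g.symm _ _ _
  rw [map_sub, sub_apply, e1, e2, h1, h2]
  simp only [koszul, s1, s2, s3, FiberBundle.extend_apply_self,
    VectorField.mlieBracket_swap_apply (V := Y) (W := X),
    VectorField.mlieBracket_swap_apply (V := Y) (W := FiberBundle.extend E u),
    VectorField.mlieBracket_swap_apply (V := X) (W := FiberBundle.extend E u)]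
  simp
  ring

theorem leviCivita_metric (g : Metric E M) {x : M} {X Y Z : VField E M}
    (hX : MDiffAt (T% X) x) (hY : MDiffAt (T% Y) x) (hZ : MDiffAt (T% Z) x) :
    mvfderiv 𝓘(ℝ, E) (fun y ↦ g.inner y (Y y) (Z y)) x (X x) =
      g.inner x (leviCivita g Y x (X x)) (Z x) + g.inner x (Y x) (leviCivita g Z x (X x)) := by
  have e1 : leviCivita g Y x (X x) = koszulCov g Y x (X x) := rfl
  have e2 : leviCivita g Z x (X x) = koszulCov g Z x (X x) := rfl
  rw [e1, e2, g.symm x (Y x), inner_koszulCov g hX hY hZ, inner_koszulCov g hX hZ hY]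
  have s1 : (fun y ↦ g.inner y (Z y) (Y y)) =
      fun y ↦ g.inner y (Y y) (Z y) := funext fun y ↦ g.symm _ _ _
  have s2 : (fun y ↦ g.inner y (X y) (Y y)) =
      fun y ↦ g.inner y (Y y) (X y) := funext fun y ↦ g.symm _ _ _
  have s3 : (fun y ↦ g.inner y (X y) (Z y)) =
      fun y ↦ g.inner y (Z y) (X y) := funext fun y ↦ g.symm _ _ _
  simp only [koszul, s1, s2, s3, VectorField.mlieBracket_swap_apply (V := Z) (W := X),
    VectorField.mlieBracket_swap_apply (V := Y) (W := X),
    VectorField.mlieBracket_swap_apply (V := Z) (W := Y)]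
  simp
  ring



/-! ### Foliations -/

variable (E M) in
/-- A smooth foliation with `p`-dimensional leaves, encoded by its tangent distribution: around
every point there is a smooth chart `φ` in which the leaves are the level sets
`φ ⁻¹' (a + L)` (the plaques), for a fixed `p`-dimensional subspace `L`. -/
structure Foliation (p : ℕ) where
  /-- The vectors at `x` that are tangent to the leaf through `x`. -/
  tangent (x : M) : Submodule ℝ (TangentSpace 𝓘(ℝ, E) x)
  exists_flat_chart (x : M) : ∃ φ ∈ IsManifold.maximalAtlas 𝓘(ℝ, E) ∞ M, x ∈ φ.source ∧
    ∃ L : Submodule ℝ E, Module.finrank ℝ L = p ∧ ∀ y ∈ φ.source,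
      ∀ v : TangentSpace 𝓘(ℝ, E) y, v ∈ tangent y ↔ mfderiv 𝓘(ℝ, E) 𝓘(ℝ, E) φ y v ∈ L

/-- The vectors at `x` that are `g`-orthogonal to the leaf through `x`. -/
def Foliation.normal {p : ℕ} (F : Foliation E M p) (g : Metric E M) (x : M) :
    Submodule ℝ (TangentSpace 𝓘(ℝ, E) x) where
  carrier := {w | ∀ v ∈ F.tangent x, g.inner x v w = 0}
  add_mem' {a b} ha hb v hv := by rw [map_add, ha v hv, hb v hv, add_zero]
  zero_mem' v _ := map_zero _
  smul_mem' c a ha v hv := by rw [map_smul, ha v hv, smul_zero]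

theorem Foliation.isCompl {p : ℕ} (F : Foliation E M p) (g : Metric E M) (x : M) :
    IsCompl (F.tangent x) (F.normal g x) := by
  have hfd : FiniteDimensional ℝ (TangentSpace 𝓘(ℝ, E) x) :=
    inferInstanceAs (FiniteDimensional ℝ E)
  let B : LinearMap.BilinForm ℝ (TangentSpace 𝓘(ℝ, E) x) :=
    ContinuousLinearMap.coeLM ℝ ∘ₗ (g.inner x : _ →ₗ[ℝ] _)
  have hB : B.IsRefl := fun v w h ↦ (g.symm x w v).trans h
  have hd : Disjoint (F.tangent x) (B.orthogonal (F.tangent x)) := by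
    rw [Submodule.disjoint_def]
    intro v hv hv'
    by_contra hne
    have h1 : g.inner x v v = 0 := hv' v hv
    exact (g.pos x v hne).ne' h1
  exact LinearMap.BilinForm.isCompl_orthogonal_of_restrict_nondegenerate hB
    (B.nondegenerate_restrict_of_disjoint_orthogonal hB hd)

/-- The `g`-orthogonal projection onto the vectors tangent to the foliation. -/
def Foliation.proj {p : ℕ} (F : Foliation E M p) (g : Metric E M) (x : M) :
    TangentSpace 𝓘(ℝ, E) x →ₗ[ℝ] TangentSpace 𝓘(ℝ, E) x :=
  (F.tangent x).projection (F.normal g x) (F.isCompl g x)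

/-! ### The warped metric -/

/-- A warping function: smooth, positive, and constant along the leaves of the foliation. -/
structure WarpingFunction {p : ℕ} (F : Foliation E M p) where
  toFun : M → ℝ
  contMDiff : ContMDiff 𝓘(ℝ, E) 𝓘(ℝ, ℝ) ∞ toFun
  pos (x : M) : 0 < toFun x
  basic (x : M) : ∀ v ∈ F.tangent x, mvfderiv 𝓘(ℝ, E) toFun x v = 0

/-- The inner product `g_f`: multiplied by `f ^ 2` on vectors tangent to the foliation, and equal
to `g` as soon as one of the two vectors is orthogonal to the foliation. -/
def warpedInner {p : ℕ} (g : Metric E M) {F : Foliation E M p} (f : WarpingFunction F) (x : M) :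
    TangentSpace 𝓘(ℝ, E) x →L[ℝ] TangentSpace 𝓘(ℝ, E) x →L[ℝ] ℝ :=
  have : FiniteDimensional ℝ (TangentSpace 𝓘(ℝ, E) x) := inferInstanceAs (FiniteDimensional ℝ E)
  have : T2Space (TangentSpace 𝓘(ℝ, E) x) := inferInstanceAs (T2Space E)
  LinearMap.toContinuousBilinearMap <| LinearMap.mk₂ ℝ
    (fun v w ↦ f.toFun x ^ 2 * g.inner x (F.proj g x v) (F.proj g x w)
      + g.inner x (v - F.proj g x v) (w - F.proj g x w))
    (fun v v' w ↦ by simp; ring) (fun c v w ↦ by simp; ring)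
    (fun v w w' ↦ by simp; ring) (fun c v w ↦ by simp; ring)

theorem warpedInner_apply {p : ℕ} (g : Metric E M) {F : Foliation E M p} (f : WarpingFunction F)
    (x : M) (v w : TangentSpace 𝓘(ℝ, E) x) :
    warpedInner g f x v w = f.toFun x ^ 2 * g.inner x (F.proj g x v) (F.proj g x w)
      + g.inner x (v - F.proj g x v) (w - F.proj g x w) := rfl

theorem Foliation.proj_mem {p : ℕ} (F : Foliation E M p) (g : Metric E M) (x : M)
    (v : TangentSpace 𝓘(ℝ, E) x) : F.proj g x v ∈ F.tangent x :=
  Submodule.projection_apply_mem _ v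

theorem Foliation.sub_proj_mem {p : ℕ} (F : Foliation E M p) (g : Metric E M) (x : M)
    (v : TangentSpace 𝓘(ℝ, E) x) : v - F.proj g x v ∈ F.normal g x := by
  have h := Submodule.projection_add_projection_eq_self (F.isCompl g x) v
  have h' : v - F.proj g x v = (F.normal g x).projection (F.tangent x) (F.isCompl g x).symm v := by
    rw [sub_eq_iff_eq_add']; exact h.symm
  rw [h']
  exact Submodule.projection_apply_mem _ v

/-- If `v` is tangent and `w` is tangent then `g_f (v, w) = f ^ 2 * g (v, w)`. -/
theorem warpedInner_tangent {p : ℕ} (g : Metric E M) {F : Foliation E M p} (f : WarpingFunction F)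
    (x : M) {v w : TangentSpace 𝓘(ℝ, E) x} (hv : v ∈ F.tangent x) (hw : w ∈ F.tangent x) :
    warpedInner g f x v w = f.toFun x ^ 2 * g.inner x v w := by
  have h1 : F.proj g x v = v := Submodule.projection_apply_of_mem_left _ hv
  have h2 : F.proj g x w = w := Submodule.projection_apply_of_mem_left _ hw
  rw [warpedInner_apply, h1, h2, sub_self, sub_self, map_zero, add_zero]

theorem warpedInner_eq_add {p : ℕ} (g : Metric E M) {F : Foliation E M p} (f : WarpingFunction F)
    (x : M) (v w : TangentSpace 𝓘(ℝ, E) x) :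
    warpedInner g f x v w = g.inner x v w + (f.toFun x ^ 2 - 1) * g.inner x v (F.proj g x w) := by
  have h1 : g.inner x (v - F.proj g x v) (F.proj g x w) = 0 := by
    rw [g.symm]; exact F.sub_proj_mem g x v _ (F.proj_mem g x w)
  have h2 : g.inner x (F.proj g x v) (w - F.proj g x w) = 0 :=
    F.sub_proj_mem g x w _ (F.proj_mem g x v)
  rw [warpedInner_apply]
  simp only [map_sub, sub_apply] at h1 h2 ⊢
  linear_combination (f.toFun x ^ 2 - 1) * (-h1) - h2 - h1

/-- If one of the two vectors is orthogonal to the foliation then `g_f (v, w) = g (v, w)`. -/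
theorem warpedInner_normal {p : ℕ} (g : Metric E M) {F : Foliation E M p} (f : WarpingFunction F)
    (x : M) {v w : TangentSpace 𝓘(ℝ, E) x} (hw : w ∈ F.normal g x) :
    warpedInner g f x v w = g.inner x v w := by
  have h2 : F.proj g x w = 0 := (Submodule.projection_apply_eq_zero_iff _).2 hw
  rw [warpedInner_eq_add, h2, map_zero, mul_zero, add_zero]

theorem inner_self_nonneg (g : Metric E M) (x : M) (v : TangentSpace 𝓘(ℝ, E) x) :
    0 ≤ g.inner x v v := by
  rcases eq_or_ne v 0 with rfl | hv
  · simp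
  · exact (g.pos x v hv).le

theorem le_warpedInner {p : ℕ} (g : Metric E M) {F : Foliation E M p} (f : WarpingFunction F)
    (x : M) (v : TangentSpace 𝓘(ℝ, E) x) :
    min 1 (f.toFun x ^ 2) * g.inner x v v ≤ warpedInner g f x v v := by
  have h1 : g.inner x v v = g.inner x (F.proj g x v) (F.proj g x v)
      + g.inner x (v - F.proj g x v) (v - F.proj g x v) := by
    have h1 : g.inner x (v - F.proj g x v) (F.proj g x v) = 0 := by
      rw [g.symm]; exact F.sub_proj_mem g x v _ (F.proj_mem g x v)
    have h2 : g.inner x (F.proj g x v) (v - F.proj g x v) = 0 :=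
      F.sub_proj_mem g x v _ (F.proj_mem g x v)
    simp only [map_sub, sub_apply] at h1 h2 ⊢
    linear_combination h1 + h2
  rw [h1, warpedInner_apply]
  nlinarith [min_le_left 1 (f.toFun x ^ 2), min_le_right 1 (f.toFun x ^ 2),
    inner_self_nonneg g x (F.proj g x v), inner_self_nonneg g x (v - F.proj g x v),
    mul_le_mul_of_nonneg_right (min_le_right 1 (f.toFun x ^ 2))
      (inner_self_nonneg g x (F.proj g x v)),
    mul_le_mul_of_nonneg_right (min_le_left 1 (f.toFun x ^ 2))
      (inner_self_nonneg g x (v - F.proj g x v))]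

theorem warpedInner_pos {p : ℕ} (g : Metric E M) {F : Foliation E M p} (f : WarpingFunction F)
    (x : M) (v : TangentSpace 𝓘(ℝ, E) x) (hv : v ≠ 0) : 0 < warpedInner g f x v v :=
  (mul_pos (lt_min one_pos (pow_pos (f.pos x) 2)) (g.pos x v hv)).trans_le (le_warpedInner g f x v)

theorem warpedInner_isVonNBounded {p : ℕ} (g : Metric E M) {F : Foliation E M p}
    (f : WarpingFunction F) (x : M) :
    Bornology.IsVonNBounded ℝ {v : TangentSpace 𝓘(ℝ, E) x | warpedInner g f x v v < 1} := by
  set m := min 1 (f.toFun x ^ 2) with hm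
  have hm0 : 0 < m := lt_min one_pos (pow_pos (f.pos x) 2)
  have h := (g.isVonNBounded x).image
    ((Real.sqrt m)⁻¹ • ContinuousLinearMap.id ℝ (TangentSpace 𝓘(ℝ, E) x))
  refine Bornology.IsVonNBounded.subset (s₂ := _ '' _) ?_ h
  intro v hv
  refine ⟨Real.sqrt m • v, ?_, ?_⟩
  · have h1 := le_warpedInner g f x v
    have h2 : g.inner x (Real.sqrt m • v) (Real.sqrt m • v) = m * g.inner x v v := by
      simp only [map_smul, smul_apply, smul_eq_mul, ← mul_assoc]
      rw [Real.mul_self_sqrt hm0.le]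
    exact (h2.trans_le h1).trans_lt hv
  · have h3 : Real.sqrt m ≠ 0 := (Real.sqrt_pos.2 hm0).ne'
    simp [smul_smul, h3]

section smoothness

variable {L : Type*} [NormedAddCommGroup L] [NormedSpace ℝ L]

/-- The pull-back of a bilinear form along a linear map. -/
def gram (G : E →L[ℝ] E →L[ℝ] ℝ) (A : L →L[ℝ] E) : L →L[ℝ] L →L[ℝ] ℝ :=
  ((ContinuousLinearMap.compL ℝ L E ℝ).flip A).comp (G.comp A)

/-- The orthogonal projection onto the range of an injective linear map, in closed form. -/
def gramProj (G : E →L[ℝ] E →L[ℝ] ℝ) (A : L →L[ℝ] E) : E →L[ℝ] E :=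
  A.comp ((gram G A).inverse.comp (((ContinuousLinearMap.compL ℝ L E ℝ).flip A).comp G))

theorem gram_isInvertible [FiniteDimensional ℝ L] {G : E →L[ℝ] E →L[ℝ] ℝ} {A : L →L[ℝ] E}
    (hG : ∀ v, v ≠ 0 → 0 < G v v) (hA : Function.Injective A) : (gram G A).IsInvertible := by
  have hinj : Function.Injective (gram G A : L →ₗ[ℝ] L →L[ℝ] ℝ) := by
    rw [injective_iff_map_eq_zero]
    intro c hc
    by_contra hne
    have h1 : A c ≠ 0 := fun h ↦ hne (hA (h.trans (map_zero A).symm))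
    have h2 : G (A c) (A c) = 0 := DFunLike.congr_fun (F := L →L[ℝ] ℝ) hc c
    exact (hG _ h1).ne' h2
  have hdim : Module.finrank ℝ L = Module.finrank ℝ (L →L[ℝ] ℝ) := by
    rw [← (LinearMap.toContinuousLinearMap (𝕜 := ℝ) (E := L) (F' := ℝ)).finrank_eq]
    exact (Subspace.dual_finrank_eq (K := ℝ) (V := L)).symm
  exact ⟨(LinearEquiv.ofInjectiveOfFinrankEq _ hinj hdim).toContinuousLinearEquiv, by ext; rfl⟩

theorem gramProj_eq [FiniteDimensional ℝ L] {G : E →L[ℝ] E →L[ℝ] ℝ} {A : L →L[ℝ] E}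
    (hG : ∀ v, v ≠ 0 → 0 < G v v) (hA : Function.Injective A) {a b : E}
    (hb : b ∈ Set.range A) (hab : ∀ c, G (a - b) (A c) = 0) : gramProj G A a = b := by
  obtain ⟨c, rfl⟩ := hb
  have h1 : ((ContinuousLinearMap.compL ℝ L E ℝ).flip A) (G a) = gram G A c := by
    ext d
    have := hab d
    rw [map_sub, sub_apply, sub_eq_zero] at this
    exact this
  have h2 : (gram G A).inverse (gram G A c) = c :=
    (gram_isInvertible hG hA).inverse_apply_eq.2 rfl
  change A ((gram G A).inverse (((ContinuousLinearMap.compL ℝ L E ℝ).flip A) (G a))) = A c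
  rw [h1, h2]

theorem contDiff_flip_compL :
    ContDiff ℝ ∞ (fun A : L →L[ℝ] E ↦ (ContinuousLinearMap.compL ℝ L E ℝ).flip A) := by
  fun_prop

set_option synthInstance.maxHeartbeats 200000 in
theorem contDiffAt_gramProj [FiniteDimensional ℝ L] {G : E →L[ℝ] E →L[ℝ] ℝ} {A : L →L[ℝ] E}
    (hG : ∀ v, v ≠ 0 → 0 < G v v) (hA : Function.Injective A) :
    ContDiffAt ℝ ∞ (fun q : (E →L[ℝ] E →L[ℝ] ℝ) × (L →L[ℝ] E) ↦ gramProj q.1 q.2) (G, A) := by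
  have hL : CompleteSpace L := FiniteDimensional.complete ℝ L
  have h1 : ContDiff ℝ ∞ (fun q : (E →L[ℝ] E →L[ℝ] ℝ) × (L →L[ℝ] E) ↦
      (ContinuousLinearMap.compL ℝ L E ℝ).flip q.2) :=
    contDiff_flip_compL.comp contDiff_snd
  have h2 : ContDiff ℝ ∞ (fun q : (E →L[ℝ] E →L[ℝ] ℝ) × (L →L[ℝ] E) ↦ gram q.1 q.2) :=
    h1.clm_comp (contDiff_fst.clm_comp contDiff_snd)
  have h3 : ContDiffAt ℝ ∞ (fun q : (E →L[ℝ] E →L[ℝ] ℝ) × (L →L[ℝ] E) ↦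
      (gram q.1 q.2).inverse) (G, A) := by
    obtain ⟨e, he⟩ := gram_isInvertible hG hA
    have h4 : ContDiffAt ℝ ∞ ContinuousLinearMap.inverse (gram G A) := by
      rw [← he]; exact contDiffAt_map_inverse e
    exact h4.comp (G, A) h2.contDiffAt
  exact contDiff_snd.contDiffAt.clm_comp (h3.clm_comp (h1.clm_comp contDiff_fst).contDiffAt)

end smoothness

/-- The inner products `g_f` depend smoothly on the base point. -/
theorem contMDiff_warpedInner {p : ℕ} (g : Metric E M) {F : Foliation E M p}
    (f : WarpingFunction F) :
    ContMDiff 𝓘(ℝ, E) (𝓘(ℝ, E).prod 𝓘(ℝ, E →L[ℝ] E →L[ℝ] ℝ)) ∞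
      (fun x ↦ TotalSpace.mk' (E →L[ℝ] E →L[ℝ] ℝ)
        (E := fun x : M ↦ TangentSpace 𝓘(ℝ, E) x →L[ℝ] TangentSpace 𝓘(ℝ, E) x →L[ℝ] ℝ)
        x (warpedInner g f x)) := by
  intro x₀
  obtain ⟨φ, hφ, hx₀, L, -, hL⟩ := F.exists_flat_chart x₀
  have hg := g.contMDiff x₀
  rw [contMDiffAt_hom_bundle] at hg ⊢
  refine ⟨contMDiffAt_id, ?_⟩
  replace hg := hg.2
  set t := trivializationAt E (TangentSpace 𝓘(ℝ, E) : M → Type _) x₀ with ht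
  let G : M → E →L[ℝ] E →L[ℝ] ℝ := fun y ↦
    ContinuousLinearMap.inCoordinates E (TangentSpace 𝓘(ℝ, E) : M → Type _) (E →L[ℝ] ℝ)
      (fun y : M ↦ TangentSpace 𝓘(ℝ, E) y →L[ℝ] ℝ) x₀ y x₀ y (g.inner y)
  have hGs : ContMDiffAt 𝓘(ℝ, E) 𝓘(ℝ, E →L[ℝ] E →L[ℝ] ℝ) ∞ G x₀ := hg
  let κ : E → E := chartAt E x₀ ∘ φ.symm
  let K : M → L →L[ℝ] E := fun y ↦ (fderiv ℝ κ (φ y)).comp L.subtypeL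
  let U : Set M := φ.source ∩ (chartAt E x₀).source
  have hU : U ∈ 𝓝 x₀ := (φ.open_source.inter (chartAt E x₀).open_source).mem_nhds
    ⟨hx₀, mem_chart_source E x₀⟩
  -- smoothness of the transition map and of its derivative
  have hκ : ∀ y ∈ U, ContDiffAt ℝ ∞ κ (φ y) := by
    intro y hy
    rw [← contMDiffAt_iff_contDiffAt]
    have h1 : ContMDiffAt 𝓘(ℝ, E) 𝓘(ℝ, E) ∞ φ.symm (φ y) :=
      (contMDiffOn_symm_of_mem_maximalAtlas hφ).contMDiffAt
        (φ.open_target.mem_nhds (φ.map_source hy.1))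
    have h2 : ContMDiffAt 𝓘(ℝ, E) 𝓘(ℝ, E) ∞ (chartAt E x₀) (φ.symm (φ y)) := by
      rw [φ.left_inv hy.1]
      exact (contMDiffOn_chart (I := 𝓘(ℝ, E))).contMDiffAt
        ((chartAt E x₀).open_source.mem_nhds hy.2)
    exact h2.comp _ h1
  have hφs : ContMDiffAt 𝓘(ℝ, E) 𝓘(ℝ, E) ∞ φ x₀ :=
    (contMDiffOn_of_mem_maximalAtlas hφ).contMDiffAt (φ.open_source.mem_nhds hx₀)
  have hKs : ContMDiffAt 𝓘(ℝ, E) 𝓘(ℝ, L →L[ℝ] E) ∞ K x₀ := by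
    have h1 : ContDiffAt ℝ ∞ (fun u ↦ (fderiv ℝ κ u).comp L.subtypeL) (φ x₀) :=
      ((hκ x₀ ⟨hx₀, mem_chart_source E x₀⟩).fderiv_right (by simp)).clm_comp contDiffAt_const
    exact h1.contMDiffAt.comp x₀ hφs
  -- the trivialization, expressed through the flat chart
  have hφd : φ.MDifferentiable 𝓘(ℝ, E) 𝓘(ℝ, E) :=
    ⟨(contMDiffOn_of_mem_maximalAtlas hφ).mdifferentiableOn (by simp),
      (contMDiffOn_symm_of_mem_maximalAtlas hφ).mdifferentiableOn (by simp)⟩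
  have htK : ∀ y ∈ U, ∀ v : TangentSpace 𝓘(ℝ, E) y,
      t.continuousLinearMapAt ℝ y v = fderiv ℝ κ (φ y) (mfderiv 𝓘(ℝ, E) 𝓘(ℝ, E) φ y v) := by
    intro y hy v
    have h1 : HasMFDerivAt 𝓘(ℝ, E) 𝓘(ℝ, E) φ y (mfderiv 𝓘(ℝ, E) 𝓘(ℝ, E) φ y) :=
      (hφd.mdifferentiableAt hy.1).hasMFDerivAt
    have h2 : HasMFDerivAt 𝓘(ℝ, E) 𝓘(ℝ, E) κ (φ y) (fderiv ℝ κ (φ y)) :=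
      ((hκ y hy).differentiableAt (by simp)).hasFDerivAt.hasMFDerivAt
    have h3 := HasMFDerivAt.comp y h2 h1
    have h4 : extChartAt 𝓘(ℝ, E) x₀ =ᶠ[𝓝 y] κ ∘ φ := by
      filter_upwards [φ.open_source.mem_nhds hy.1] with z hz
      simp [κ, φ.left_inv hz]
    have h5 : t.continuousLinearMapAt ℝ y = mfderiv 𝓘(ℝ, E) 𝓘(ℝ, E) (extChartAt 𝓘(ℝ, E) x₀) y :=
      TangentBundle.continuousLinearMapAt_trivializationAt hy.2
    have h6 := (h3.congr_of_eventuallyEq h4).mfderiv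
    exact DFunLike.congr_fun (h5.trans h6) v
  have hbij : ∀ y ∈ U, Function.Bijective (mfderiv 𝓘(ℝ, E) 𝓘(ℝ, E) φ y) :=
    fun y hy ↦ hφd.mfderiv_bijective hy.1
  have hbase : ∀ y ∈ U, y ∈ t.baseSet := fun y hy ↦ by
    rw [ht, TangentBundle.trivializationAt_baseSet]; exact hy.2
  have htinv : ∀ y ∈ U, ∀ v : TangentSpace 𝓘(ℝ, E) y,
      t.symm y (t.continuousLinearMapAt ℝ y v) = v := fun y hy v ↦ by
    rw [← t.symmL_apply (R := ℝ) (hbase y hy)]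
    exact t.symmL_continuousLinearMapAt (R := ℝ) (hbase y hy) v
  have htinv' : ∀ y ∈ U, ∀ a : E, t.continuousLinearMapAt ℝ y (t.symm y a) = a := fun y hy a ↦ by
    rw [← t.symmL_apply (R := ℝ) (hbase y hy)]
    exact t.continuousLinearMapAt_symmL (R := ℝ) (hbase y hy) a
  have hKinj : ∀ y ∈ U, Function.Injective (K y) := by
    intro y hy a b hab
    obtain ⟨v, hv⟩ := (hbij y hy).2 (a : E)
    obtain ⟨w, hw⟩ := (hbij y hy).2 (b : E)
    have h1 : t.continuousLinearMapAt ℝ y v = t.continuousLinearMapAt ℝ y w := by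
      rw [htK y hy, htK y hy, hv, hw]; exact hab
    have h2 : v = w := by rw [← htinv y hy v, h1, htinv y hy w]
    exact Subtype.ext (hv.symm.trans ((congrArg _ h2).trans hw))
  have hGapply : ∀ y ∈ U, ∀ v w : TangentSpace 𝓘(ℝ, E) y,
      G y (t.continuousLinearMapAt ℝ y v) (t.continuousLinearMapAt ℝ y w) = g.inner y v w := by
    intro y hy v w
    have h := inCoordinates_apply_eq₂ (𝕜 := ℝ)
      (E₃ := Bundle.Trivial M ℝ) (F₃ := ℝ) (x₀ := x₀) (x := y)
      (ϕ := g.inner y) (v := t.continuousLinearMapAt ℝ y v) (w := t.continuousLinearMapAt ℝ y w)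
      (hbase y hy) (hbase y hy) (Set.mem_univ _)
    refine h.trans ?_
    rw [← ht, htinv y hy, htinv y hy]
    simp
  have hGpos : ∀ y ∈ U, ∀ a : E, a ≠ 0 → 0 < G y a a := by
    intro y hy a ha
    rw [← htinv' y hy a, hGapply y hy]
    refine g.pos y _ fun h ↦ ha ?_
    rw [← htinv' y hy a, h, map_zero]
  have hP : ∀ y ∈ U, ∀ v : TangentSpace 𝓘(ℝ, E) y,
      gramProj (G y) (K y) (t.continuousLinearMapAt ℝ y v) =
        t.continuousLinearMapAt ℝ y (F.proj g y v) := by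
    intro y hy v
    refine gramProj_eq (hGpos y hy) (hKinj y hy) ?_ fun c ↦ ?_
    · exact ⟨⟨_, (hL y hy.1 _).1 (F.proj_mem g y v)⟩, (htK y hy _).symm⟩
    · obtain ⟨w, hw⟩ := (hbij y hy).2 (c : E)
      have h1 : K y c = t.continuousLinearMapAt ℝ y w := by rw [htK y hy, hw]; rfl
      have h2 : w ∈ F.tangent y := (hL y hy.1 w).2 (by rw [hw]; exact c.2)
      rw [h1, ← map_sub, hGapply y hy, g.symm]
      exact F.sub_proj_mem g y v w h2
  have hPs : ContMDiffAt 𝓘(ℝ, E) 𝓘(ℝ, E →L[ℝ] E) ∞ (fun y ↦ gramProj (G y) (K y)) x₀ :=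
    (contDiffAt_gramProj (hGpos x₀ (mem_of_mem_nhds hU))
      (hKinj x₀ (mem_of_mem_nhds hU))).contMDiffAt.comp x₀ (hGs.prodMk_space hKs)
  have hfs : ContMDiffAt 𝓘(ℝ, E) 𝓘(ℝ, ℝ) ∞ (fun y ↦ f.toFun y ^ 2 - 1) x₀ :=
    ContDiffAt.comp_contMDiffAt (g := fun r : ℝ ↦ r ^ 2 - 1) (by fun_prop) (f.contMDiff x₀)
  have hS : ContMDiffAt 𝓘(ℝ, E) 𝓘(ℝ, E →L[ℝ] E →L[ℝ] ℝ) ∞ (fun y ↦ G y + (f.toFun y ^ 2 - 1) •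
      (((ContinuousLinearMap.compL ℝ E E ℝ).flip (gramProj (G y) (K y))).comp (G y))) x₀ := by
    refine hGs.add (hfs.smul (ContMDiffAt.clm_comp ?_ hGs))
    exact (contDiff_flip_compL (L := E)).contMDiff.contMDiffAt.comp x₀ hPs
  refine hS.congr_of_eventuallyEq ?_
  filter_upwards [hU] with y hy
  ext a b
  have h := inCoordinates_apply_eq₂ (𝕜 := ℝ)
    (E₃ := Bundle.Trivial M ℝ) (F₃ := ℝ) (x₀ := x₀) (x := y)
    (ϕ := warpedInner g f y) (v := a) (w := b)
    (hbase y hy) (hbase y hy) (Set.mem_univ _)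
  refine h.trans ?_
  rw [← ht, warpedInner_eq_add]
  have h1 : G y a b = g.inner y (t.symm y a) (t.symm y b) := by
    rw [← hGapply y hy, htinv' y hy, htinv' y hy]
  have h2 : G y a (gramProj (G y) (K y) b) =
      g.inner y (t.symm y a) (F.proj g y (t.symm y b)) := by
    rw [← hGapply y hy, htinv' y hy, ← hP y hy, htinv' y hy]
  rw [← h1, ← h2]
  simp

/-- The warped metric `g_f`. -/
def warpedMetric {p : ℕ} (g : Metric E M) {F : Foliation E M p} (f : WarpingFunction F) :
    Metric E M where
  inner := warpedInner g f
  symm x v w := by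
    rw [warpedInner_apply, warpedInner_apply, g.symm x (F.proj g x v), g.symm x (v - _)]
  pos := warpedInner_pos g f
  isVonNBounded := warpedInner_isVonNBounded g f
  contMDiff := contMDiff_warpedInner g f

/-! ### Riemannian foliations and sectional curvature -/

/-- The Lie derivative of the metric: `(L_U g)(X, Y) = U g(X, Y) - g([U, X], Y) - g(X, [U, Y])`. -/
def lieDerivMetric (g : Metric E M) (U X Y : VField E M) (x : M) : ℝ :=
  mvfderiv 𝓘(ℝ, E) (fun y ↦ g.inner y (X y) (Y y)) x (U x)
    - g.inner x (VectorField.mlieBracket 𝓘(ℝ, E) U X x) (Y x)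
    - g.inner x (X x) (VectorField.mlieBracket 𝓘(ℝ, E) U Y x)

/-- A vector field is smooth on the set `s`. -/
def SmoothOn (X : VField E M) (s : Set M) : Prop :=
  ContMDiffOn 𝓘(ℝ, E) (𝓘(ℝ, E).prod 𝓘(ℝ, E)) ∞
    (fun y ↦ (⟨y, X y⟩ : TangentBundle 𝓘(ℝ, E) M)) s

/-- The foliation is Riemannian: `(L_U g)(X, Y) = 0` for all (local) smooth vector fields `U`
tangent to the foliation and `X`, `Y` orthogonal to it. -/
def Foliation.IsRiemannian {p : ℕ} (F : Foliation E M p) (g : Metric E M) : Prop :=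
  ∀ s : Set M, IsOpen s → ∀ U X Y : VField E M, SmoothOn U s → SmoothOn X s → SmoothOn Y s →
    (∀ y ∈ s, U y ∈ F.tangent y) → (∀ y ∈ s, X y ∈ F.normal g y) →
    (∀ y ∈ s, Y y ∈ F.normal g y) → ∀ x ∈ s, lieDerivMetric g U X Y x = 0

/-- The curvature `R(X, Y)Z = ∇_X ∇_Y Z - ∇_Y ∇_X Z - ∇_[X, Y] Z` of the Levi-Civita connection.
Recall that `leviCivita g Z x (X x)` is `(∇_X Z)(x)`. -/
def curvature (g : Metric E M) (X Y Z : VField E M) (x : M) : TangentSpace 𝓘(ℝ, E) x :=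
  leviCivita g (fun y ↦ leviCivita g Z y (Y y)) x (X x)
    - leviCivita g (fun y ↦ leviCivita g Z y (X y)) x (Y x)
    - leviCivita g Z x (VectorField.mlieBracket 𝓘(ℝ, E) X Y x)

/-- The sectional curvature `g(R(v, w)w, v) / (g(v, v) g(w, w) - g(v, w) ^ 2)` of the plane spanned
by two linearly independent tangent vectors at `x`, which are extended to vector fields that are
smooth near `x` in order to compute `R(v, w)w`. -/
def sectionalCurvature (g : Metric E M) (x : M) (v w : TangentSpace 𝓘(ℝ, E) x) : ℝ :=
  g.inner x (curvature g (FiberBundle.extend E v) (FiberBundle.extend E w)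
      (FiberBundle.extend E w) x) v
    / (g.inner x v v * g.inner x w w - g.inner x v w ^ 2)

/-- All sectional curvatures, at all points, are equal to `k`. -/
def HasConstantSectionalCurvature (g : Metric E M) (k : ℝ) : Prop :=
  ∀ (x : M) (v w : TangentSpace 𝓘(ℝ, E) x), LinearIndependent ℝ ![v, w] →
    sectionalCurvature g x v w = k

end WarpedFoliation
end

/-! On a surface, the Gauss curvature is computed from a single function attached to the foliation,
and that function does not see a constant warping. Let `U` be a local unit field tangent to the
leaves and `N` a local unit field orthogonal to them. The Riemannian condition with both normal
arguments equal to `N` gives `g([U, N], N) = 0`, so `[U, N] = a • U` for a smooth function `a`.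

Replacing `g` by `g_f` with `f = c` keeps `U` and `N` orthogonal and `N` unit, and changes only the
squared length of `U`, from `1` to `c ^ 2`. The bracket does not involve the metric, so `a` stays
the same. This is why `IsAdaptedFrame` carries a parameter `r` for the squared length of `U`: one
computation serves both metrics (`Foliation.IsRiemannian.exists_adaptedFrame`).

In such a frame the Levi-Civita connection is determined by `a` and `r` (`leviCivita_frame`), and
`curvature_eq` shows that the sectional curvature numerator of a plane is `-(N a + a ^ 2)` times its
squared area. The curvature is therefore `-(N a + a ^ 2)`, with no trace of `r`. Flatness of `g`
says `N a + a ^ 2 = 0`, and the same formula for `g_f` then gives zero. -/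

noncomputable section
namespace WarpedFoliation

variable {E : Type*} [NormedAddCommGroup E] [NormedSpace ℝ E]
  {M : Type*} [TopologicalSpace M] [ChartedSpace E M] [IsManifold 𝓘(ℝ, E) ∞ M]

/-! ### Smooth vector fields on open sets -/

section SmoothOn

variable {s t : Set M} {X Y : VField E M} {p : M → ℝ} {x : M}

theorem SmoothOn.mdiffAt (hX : SmoothOn X s) (hs : IsOpen s) (hx : x ∈ s) : MDiffAt (T% X) x :=
  (hX.contMDiffAt (hs.mem_nhds hx)).mdifferentiableAt (by simp)

theorem SmoothOn.mono (hX : SmoothOn X s) (hts : t ⊆ s) : SmoothOn X t :=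
  ContMDiffOn.mono hX hts

theorem SmoothOn.add (hX : SmoothOn X s) (hY : SmoothOn Y s) : SmoothOn (X + Y) s :=
  ContMDiffOn.add_section hX hY

theorem SmoothOn.sub (hX : SmoothOn X s) (hY : SmoothOn Y s) : SmoothOn (X - Y) s :=
  ContMDiffOn.sub_section hX hY

theorem SmoothOn.smul (hX : SmoothOn X s) (hp : ContMDiffOn 𝓘(ℝ, E) 𝓘(ℝ, ℝ) ∞ p s) :
    SmoothOn (p • X) s :=
  ContMDiffOn.smul_section hp hX

theorem SmoothOn.inner (hX : SmoothOn X s) (hY : SmoothOn Y s) (g : Metric E M) :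
    ContMDiffOn 𝓘(ℝ, E) 𝓘(ℝ, ℝ) ∞ (fun y ↦ g.inner y (X y) (Y y)) s := by
  intro x hx
  have h : ContMDiffWithinAt 𝓘(ℝ, E) (𝓘(ℝ, E).prod 𝓘(ℝ, ℝ)) ∞
      (fun y ↦ TotalSpace.mk' ℝ (E := Bundle.Trivial M ℝ) y (g.inner y (X y) (Y y))) s x :=
    ContMDiffWithinAt.clm_bundle_apply₂ (F₁ := E) (F₂ := E)
      (g.contMDiff.contMDiffAt (x := x)).contMDiffWithinAt (hX x hx) (hY x hx)
  simp only [contMDiffWithinAt_totalSpace] at h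
  exact h.2

theorem SmoothOn.mlieBracket [CompleteSpace E] (hX : SmoothOn X s) (hY : SmoothOn Y s)
    (hs : IsOpen s) : SmoothOn (VectorField.mlieBracket 𝓘(ℝ, E) X Y) s := by
  have : IsManifold 𝓘(ℝ, E) (minSmoothness ℝ 2) M :=
    IsManifold.of_le (n := ∞) (by simpa using WithTop.coe_le_coe.2 (le_top : (2 : ℕ∞) ≤ ⊤))
  -- Since `∞ + 1 = ∞`, the derivative consumed by the bracket costs no regularity.
  have : IsManifold 𝓘(ℝ, E) ((∞ : ℕ∞ω) + 1) M := by simpa using ‹IsManifold 𝓘(ℝ, E) ∞ M›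
  intro x hx
  exact (ContMDiffAt.mlieBracket_vectorField (m := ⊤) (n := ⊤)
    (hX.contMDiffAt (hs.mem_nhds hx)) (hY.contMDiffAt (hs.mem_nhds hx))
    (by simp)).contMDiffWithinAt

/-- `sectionalCurvature` is defined through `FiberBundle.extend`, while the frame computations need
fields that are smooth on an open set; this connects the two. -/
theorem exists_smoothOn_extend [FiniteDimensional ℝ E] (v : TangentSpace 𝓘(ℝ, E) x) :
    ∃ s : Set M, IsOpen s ∧ x ∈ s ∧ SmoothOn (FiberBundle.extend E v : VField E M) s := by
  obtain ⟨s, hs, hsm⟩ := FiberBundle.exists_contMDiffOn_extend (k := ∞) 𝓘(ℝ, E) E v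
  obtain ⟨t, hts, ht, hxt⟩ := mem_nhds_iff.1 hs
  exact ⟨t, ht, hxt, hsm.mono hts⟩

/-- The derivative of a smooth function along a smooth vector field is smooth wherever some smooth
vector field has unit length. -/
theorem contMDiffOn_mvfderiv [CompleteSpace E] (g : Metric E M) {N : VField E M}
    (hs : IsOpen s) (hN : SmoothOn N s) (hNN : ∀ y ∈ s, g.inner y (N y) (N y) = 1)
    (hX : SmoothOn X s) (hp : ContMDiffOn 𝓘(ℝ, E) 𝓘(ℝ, ℝ) ∞ p s) :
    ContMDiffOn 𝓘(ℝ, E) 𝓘(ℝ, ℝ) ∞ (fun y ↦ mvfderiv 𝓘(ℝ, E) p y (X y)) s := by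
  -- The Leibniz rule `[X, p N] = X(p) N + p [X, N]`, paired with the unit field `N`, gives `X(p) =
  -- g([X, p N] - p [X, N], N)`, whose right side is visibly smooth.
  have h := (((hX.mlieBracket (hN.smul hp) hs).sub
    ((hX.mlieBracket hN hs).smul hp)).inner hN g)
  refine h.congr fun y hy ↦ ?_
  have hpy : MDiffAt p y := (hp.contMDiffAt (hs.mem_nhds hy)).mdifferentiableAt (by simp)
  simp [VectorField.mlieBracket_smul_right hpy (hN.mdiffAt hs hy), hNN y hy]

/-- The Lie bracket acts on functions as the commutator of the derivations. -/
theorem mvfderiv_mlieBracket [CompleteSpace E] (g : Metric E M) {N : VField E M}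
    (hs : IsOpen s) (hN : SmoothOn N s) (hNN : ∀ y ∈ s, g.inner y (N y) (N y) = 1)
    (hX : SmoothOn X s) (hY : SmoothOn Y s) (hp : ContMDiffOn 𝓘(ℝ, E) 𝓘(ℝ, ℝ) ∞ p s)
    (hx : x ∈ s) :
    mvfderiv 𝓘(ℝ, E) p x (VectorField.mlieBracket 𝓘(ℝ, E) X Y x) =
      mvfderiv 𝓘(ℝ, E) (fun y ↦ mvfderiv 𝓘(ℝ, E) p y (Y y)) x (X x)
        - mvfderiv 𝓘(ℝ, E) (fun y ↦ mvfderiv 𝓘(ℝ, E) p y (X y)) x (Y x) := by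
  have : IsManifold 𝓘(ℝ, E) (minSmoothness ℝ 3) M :=
    IsManifold.of_le (n := ∞) (by simpa using WithTop.coe_le_coe.2 (le_top : (3 : ℕ∞) ≤ ⊤))
  have : IsManifold 𝓘(ℝ, E) (minSmoothness ℝ 2) M :=
    IsManifold.of_le (n := ∞) (by simpa using WithTop.coe_le_coe.2 (le_top : (2 : ℕ∞) ≤ ⊤))
  have hd {q : M → ℝ} (hq : ContMDiffOn 𝓘(ℝ, E) 𝓘(ℝ, ℝ) ∞ q s) {y : M} (hy : y ∈ s) :
      MDiffAt q y := (hq.contMDiffAt (hs.mem_nhds hy)).mdifferentiableAt (by simp)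
  have h2 {W : VField E M} (hW : SmoothOn W s) : CMDiffAt (minSmoothness ℝ 2) (T% W) x :=
    (hW.contMDiffAt (hs.mem_nhds hx)).of_le
      (by simpa using WithTop.coe_le_coe.2 (le_top : (2 : ℕ∞) ≤ ⊤))
  have hexp {W : VField E M} : VectorField.mlieBracket 𝓘(ℝ, E) W (p • N) =ᶠ[𝓝 x]
      ((fun y ↦ mvfderiv 𝓘(ℝ, E) p y (W y)) • N + p • VectorField.mlieBracket 𝓘(ℝ, E) W N :
        VField E M) := by
    filter_upwards [hs.mem_nhds hx] with y hy
    rw [VectorField.mlieBracket_smul_right (hd hp hy) (hN.mdiffAt hs hy)]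
    rfl
  have hX' := contMDiffOn_mvfderiv g hs hN hNN hX hp
  have hY' := contMDiffOn_mvfderiv g hs hN hNN hY hp
  have hdd {W V : VField E M} (hW : SmoothOn W s)
      (hW' : ContMDiffOn 𝓘(ℝ, E) 𝓘(ℝ, ℝ) ∞ (fun y ↦ mvfderiv 𝓘(ℝ, E) p y (W y)) s) :
      VectorField.mlieBracket 𝓘(ℝ, E) V (VectorField.mlieBracket 𝓘(ℝ, E) W (p • N)) x =
        mvfderiv 𝓘(ℝ, E) (fun y ↦ mvfderiv 𝓘(ℝ, E) p y (W y)) x (V x) • N x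
        + mvfderiv 𝓘(ℝ, E) p x (W x) • VectorField.mlieBracket 𝓘(ℝ, E) V N x
        + (mvfderiv 𝓘(ℝ, E) p x (V x) • VectorField.mlieBracket 𝓘(ℝ, E) W N x
        + p x • VectorField.mlieBracket 𝓘(ℝ, E) V (VectorField.mlieBracket 𝓘(ℝ, E) W N) x) := by
    have hWN := hW.mlieBracket hN hs
    rw [(Filter.EventuallyEq.refl _ V).mlieBracket_vectorField_eq hexp,
      VectorField.mlieBracket_add_right ((hN.smul hW').mdiffAt hs hx)
        ((hWN.smul hp).mdiffAt hs hx),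
      VectorField.mlieBracket_smul_right (hd hW' hx) (hN.mdiffAt hs hx),
      VectorField.mlieBracket_smul_right (hd hp hx) (hWN.mdiffAt hs hx)]
  -- Jacobi for `X, Y, p N`, minus `p` times Jacobi for `X, Y, N`. The mixed terms `X(p) [Y, N] +
  -- Y(p) [X, N]` are symmetric in `X, Y` and cancel, leaving the commutator identity multiplied by
  -- `N`; pairing with `N` extracts it.
  have h := VectorField.leibniz_identity_mlieBracket_apply (h2 hX) (h2 hY) (h2 (hN.smul hp))
  have h' := VectorField.leibniz_identity_mlieBracket_apply (h2 hX) (h2 hY) (h2 hN)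
  rw [hdd hY hY', hdd hX hX', VectorField.mlieBracket_smul_right (hd hp hx) (hN.mdiffAt hs hx),
    h'] at h
  have h3 := congrArg (fun v ↦ g.inner x v (N x)) h
  simp only [map_add, map_smul, add_apply, smul_apply, hNN x hx, smul_eq_mul] at h3
  linarith

end SmoothOn

/-! ### Curvature in an adapted frame -/

/-- An orthogonal frame `(U, N)` on an open set, with `U` of constant squared length `r`, `N` of
unit length, and `[U, N] = a • U`. -/
structure IsAdaptedFrame (g : Metric E M) (s : Set M) (U N : VField E M) (a : M → ℝ) (r : ℝ) :
    Prop where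
  isOpen : IsOpen s
  smooth_left : SmoothOn U s
  smooth_right : SmoothOn N s
  smooth_coeff : ContMDiffOn 𝓘(ℝ, E) 𝓘(ℝ, ℝ) ∞ a s
  ne_zero : r ≠ 0
  inner_left : ∀ y ∈ s, g.inner y (U y) (U y) = r
  inner_right : ∀ y ∈ s, g.inner y (N y) (N y) = 1
  inner_left_right : ∀ y ∈ s, g.inner y (U y) (N y) = 0
  mlieBracket_eq : ∀ y ∈ s, VectorField.mlieBracket 𝓘(ℝ, E) U N y = a y • U y
  exists_eq : ∀ y ∈ s, ∀ v : TangentSpace 𝓘(ℝ, E) y, ∃ p q : ℝ, v = p • U y + q • N y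

/-! ### Locality and product rules for the connection -/

theorem leviCivita_congr [FiniteDimensional ℝ E] (g : Metric E M) {x : M} {X Y : VField E M}
    (hY : MDiffAt (T% Y) x) (h : X =ᶠ[𝓝 x] Y) : leviCivita g X x = leviCivita g Y x := by
  have hX : MDiffAt (T% X) x :=
    hY.congr_of_eventuallyEq (h.mono fun y hy ↦ by simp [hy])
  exact (leviCivita g).isCovariantDerivativeOnUniv.congr_of_eventuallyEq hX hY Filter.univ_mem h

theorem leviCivita_add [FiniteDimensional ℝ E] (g : Metric E M) {x : M} {X Y : VField E M}
    (hX : MDiffAt (T% X) x) (hY : MDiffAt (T% Y) x) :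
    leviCivita g (X + Y) x = leviCivita g X x + leviCivita g Y x :=
  (leviCivita g).isCovariantDerivativeOnUniv.add hX hY

theorem leviCivita_smul_apply [FiniteDimensional ℝ E] (g : Metric E M) {x : M} {X : VField E M}
    {p : M → ℝ} (hp : MDiffAt p x) (hX : MDiffAt (T% X) x) (v : TangentSpace 𝓘(ℝ, E) x) :
    leviCivita g (p • X) x v = p x • leviCivita g X x v + mvfderiv 𝓘(ℝ, E) p x v • X x := by
  have h := (leviCivita g).isCovariantDerivativeOnUniv.leibniz hX hp
  exact (DFunLike.congr_fun h v).trans (by simp)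

theorem mvfderiv_congr {p q : M → ℝ} {x : M} (h : p =ᶠ[𝓝 x] q) :
    mvfderiv 𝓘(ℝ, E) p x = mvfderiv 𝓘(ℝ, E) q x := by
  simp only [mvfderiv]
  rw [h.mfderiv_eq, h.self_of_nhds]

theorem mvfderiv_eq_zero_of_eqOn_const {p : M → ℝ} {s : Set M} (hs : IsOpen s) {c : ℝ}
    (hp : ∀ y ∈ s, p y = c) {x : M} (hx : x ∈ s) : mvfderiv 𝓘(ℝ, E) p x = 0 := by
  have h : p =ᶠ[𝓝 x] fun _ ↦ c := by filter_upwards [hs.mem_nhds hx] with y hy using hp y hy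
  rw [mvfderiv_congr h, mvfderiv_const]

/-! ### Connection, brackets and curvature in frame coefficients -/

namespace IsAdaptedFrame

variable [FiniteDimensional ℝ E] {g : Metric E M} {s : Set M} {U N : VField E M} {a : M → ℝ}
  {r : ℝ} {x : M}

theorem mono (H : IsAdaptedFrame g s U N a r) {t : Set M} (ht : IsOpen t) (hts : t ⊆ s) :
    IsAdaptedFrame g t U N a r where
  isOpen := ht
  smooth_left := H.smooth_left.mono hts
  smooth_right := H.smooth_right.mono hts
  smooth_coeff := H.smooth_coeff.mono hts
  ne_zero := H.ne_zero
  inner_left y hy := H.inner_left y (hts hy)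
  inner_right y hy := H.inner_right y (hts hy)
  inner_left_right y hy := H.inner_left_right y (hts hy)
  mlieBracket_eq y hy := H.mlieBracket_eq y (hts hy)
  exists_eq y hy := H.exists_eq y (hts hy)

theorem ext_inner (H : IsAdaptedFrame g s U N a r) (hx : x ∈ s) {v w : TangentSpace 𝓘(ℝ, E) x}
    (h1 : g.inner x v (U x) = g.inner x w (U x)) (h2 : g.inner x v (N x) = g.inner x w (N x)) :
    v = w := by
  refine inner_nondegenerate g fun u ↦ ?_
  obtain ⟨p, q, rfl⟩ := H.exists_eq x hx u
  simp [h1, h2]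

/-- The inner products of the frame are constant, so differentiating them gives skew-symmetry of the
connection, and vanishing torsion gives `∇_U N - ∇_N U = a U`. These relations leave no freedom. In
particular the frame is parallel along `N`. -/
theorem leviCivita_frame (H : IsAdaptedFrame g s U N a r) (hx : x ∈ s) :
    leviCivita g U x (U x) = -(r * a x) • N x ∧ leviCivita g U x (N x) = 0 ∧
      leviCivita g N x (U x) = a x • U x ∧ leviCivita g N x (N x) = 0 := by
  have hU := H.smooth_left.mdiffAt H.isOpen hx
  have hN := H.smooth_right.mdiffAt H.isOpen hx
  have nl := H.inner_left_right x hx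
  have ll := H.inner_left x hx
  have rr := H.inner_right x hx
  have ln : g.inner x (N x) (U x) = 0 := (g.symm x _ _).trans nl
  have tor := ((leviCivita g).torsion_eq_zero_iff.1 (leviCivita_torsion g)) hU hN
  rw [H.mlieBracket_eq x hx, sub_eq_iff_eq_add] at tor
  have hUU (X : VField E M) (hX : MDiffAt (T% X) x) := leviCivita_metric g hX hU hU
  have hNN (X : VField E M) (hX : MDiffAt (T% X) x) := leviCivita_metric g hX hN hN
  have hUN (X : VField E M) (hX : MDiffAt (T% X) x) := leviCivita_metric g hX hU hN
  simp only [mvfderiv_eq_zero_of_eqOn_const H.isOpen H.inner_left hx,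
    mvfderiv_eq_zero_of_eqOn_const H.isOpen H.inner_right hx,
    mvfderiv_eq_zero_of_eqOn_const H.isOpen H.inner_left_right hx, zero_apply,
    g.symm x (U x) (leviCivita g _ x _), g.symm x (N x) (leviCivita g _ x _)] at hUU hNN hUN
  have a1 := hUU U hU
  have a2 := hUU N hN
  have a3 := hNN U hU
  have a4 := hNN N hN
  have a5 := hUN U hU
  have a6 := hUN N hN
  have b1 : leviCivita g U x (N x) = 0 := by
    refine H.ext_inner hx ?_ ?_
    · simp; linarith
    -- Here `g(∇_U N, N) = 0`, and `∇_U N` differs from `∇_N U` by a multiple of `U`, which is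
    -- orthogonal to `N`.
    · rw [tor] at a3
      simp [nl] at a3
      simp; linarith
  rw [b1, add_zero] at tor
  rw [tor] at a5
  rw [b1] at a6
  refine ⟨H.ext_inner hx ?_ ?_, b1, tor, H.ext_inner hx ?_ ?_⟩
  · simp [ln]; linarith
  · simp [ll] at a5
    simp [rr]; linarith
  · simp at a6 ⊢; linarith
  · simp; linarith

/-- The Leibniz rule: differentiate the coefficients and add the turning of the frame. The latter
involves only the `U`-component `p` of the direction, because the frame is parallel along `N`. -/
theorem leviCivita_apply (H : IsAdaptedFrame g s U N a r) (hx : x ∈ s) {Z : VField E M}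
    {z₁ z₂ : M → ℝ} (hz₁ : MDiffAt z₁ x) (hz₂ : MDiffAt z₂ x)
    (hZ : Z =ᶠ[𝓝 x] z₁ • U + z₂ • N) {v : TangentSpace 𝓘(ℝ, E) x} {p q : ℝ}
    (hv : v = p • U x + q • N x) :
    leviCivita g Z x v = (mvfderiv 𝓘(ℝ, E) z₁ x v + a x * p * z₂ x) • U x +
      (mvfderiv 𝓘(ℝ, E) z₂ x v - r * a x * p * z₁ x) • N x := by
  have hU := H.smooth_left.mdiffAt H.isOpen hx
  have hN := H.smooth_right.mdiffAt H.isOpen hx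
  have h1 := hz₁.smul_section hU
  have h2 := hz₂.smul_section hN
  obtain ⟨c1, c2, c3, c4⟩ := H.leviCivita_frame hx
  have e1 : leviCivita g U x v = -(r * a x * p) • N x := by
    rw [hv, map_add, map_smul, map_smul, c1, c2]; module
  have e2 : leviCivita g N x v = (a x * p) • U x := by
    rw [hv, map_add, map_smul, map_smul, c3, c4]; module
  rw [leviCivita_congr g (mdifferentiableAt_add_section h1 h2) hZ, leviCivita_add g h1 h2,
    add_apply, leviCivita_smul_apply g hz₁ hU, leviCivita_smul_apply g hz₂ hN, e1, e2]
  module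

/-- The coefficients in an adapted frame of a smooth vector field are smooth. -/
theorem exists_smooth_coeff (H : IsAdaptedFrame g s U N a r) {X : VField E M}
    (hX : SmoothOn X s) : ∃ x₁ x₂ : M → ℝ, ContMDiffOn 𝓘(ℝ, E) 𝓘(ℝ, ℝ) ∞ x₁ s ∧
      ContMDiffOn 𝓘(ℝ, E) 𝓘(ℝ, ℝ) ∞ x₂ s ∧ ∀ y ∈ s, X y = x₁ y • U y + x₂ y • N y := by
  -- Orthogonal projection onto the frame; the factor `r⁻¹` compensates for the squared length `r`
  -- of `U`.
  refine ⟨fun y ↦ r⁻¹ * g.inner y (X y) (U y), fun y ↦ g.inner y (X y) (N y),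
    contMDiffOn_const.mul (hX.inner H.smooth_left g), hX.inner H.smooth_right g, fun y hy ↦ ?_⟩
  have nl := H.inner_left_right y hy
  have ln : g.inner y (N y) (U y) = 0 := (g.symm y _ _).trans nl
  refine H.ext_inner hy ?_ ?_
  · simp [ln, H.inner_left y hy]; field_simp [H.ne_zero]
  · simp [nl, H.inner_right y hy]

/-- Only the `U`-component is made explicit: it is all that the frame-turning part of `∇_[X, Y]`
depends on. The derivatives of coefficients along `[X, Y]` are handled by `mvfderiv_mlieBracket`
instead. -/
theorem mlieBracket_coeff (H : IsAdaptedFrame g s U N a r) (hx : x ∈ s) {X Y : VField E M}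
    {x₁ x₂ y₁ y₂ : M → ℝ} (hx₁ : MDiffAt x₁ x) (hx₂ : MDiffAt x₂ x) (hy₁ : MDiffAt y₁ x)
    (hy₂ : MDiffAt y₂ x) (hX : X =ᶠ[𝓝 x] x₁ • U + x₂ • N) (hY : Y =ᶠ[𝓝 x] y₁ • U + y₂ • N) :
    ∃ q : ℝ, VectorField.mlieBracket 𝓘(ℝ, E) X Y x =
      (mvfderiv 𝓘(ℝ, E) y₁ x (X x) - mvfderiv 𝓘(ℝ, E) x₁ x (Y x)
        + a x * (x₁ x * y₂ x - x₂ x * y₁ x)) • U x + q • N x := by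
  have hU := H.smooth_left.mdiffAt H.isOpen hx
  have hN := H.smooth_right.mdiffAt H.isOpen hx
  rw [hX.mlieBracket_vectorField_eq hY,
    VectorField.mlieBracket_add_right (hy₁.smul_section hU) (hy₂.smul_section hN),
    VectorField.mlieBracket_smul_right hy₁ hU, VectorField.mlieBracket_smul_right hy₂ hN,
    VectorField.mlieBracket_add_left (hx₁.smul_section hU) (hx₂.smul_section hN),
    VectorField.mlieBracket_add_left (hx₁.smul_section hU) (hx₂.smul_section hN),
    VectorField.mlieBracket_smul_left hx₁ hU, VectorField.mlieBracket_smul_left hx₁ hU,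
    VectorField.mlieBracket_smul_left hx₂ hN, VectorField.mlieBracket_smul_left hx₂ hN,
    VectorField.mlieBracket_swap_apply (V := N) (W := U), H.mlieBracket_eq x hx,
    VectorField.mlieBracket_self, VectorField.mlieBracket_self, hX.self_of_nhds,
    hY.self_of_nhds]
  simp only [Pi.add_apply, Pi.smul_apply', Pi.zero_apply, map_add, map_smul, smul_eq_mul]
  exact ⟨mvfderiv 𝓘(ℝ, E) y₂ x (x₁ x • U x + x₂ x • N x)
    - mvfderiv 𝓘(ℝ, E) x₂ x (y₁ x • U x + y₂ x • N x), by
      simp only [map_add, map_smul, smul_eq_mul]; module⟩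

/-- The curvature of a surface in an adapted frame. -/
theorem curvature_eq (H : IsAdaptedFrame g s U N a r) (hx : x ∈ s) {X Y Z : VField E M}
    (hX : SmoothOn X s) (hY : SmoothOn Y s) (hZ : SmoothOn Z s) {x₁ x₂ y₁ y₂ z₁ z₂ : ℝ}
    (hXx : X x = x₁ • U x + x₂ • N x) (hYx : Y x = y₁ • U x + y₂ • N x)
    (hZx : Z x = z₁ • U x + z₂ • N x) :
    curvature g X Y Z x =
      (-(mvfderiv 𝓘(ℝ, E) a x (N x) + a x ^ 2) * (x₁ * y₂ - x₂ * y₁)) •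
        (z₂ • U x - (r * z₁) • N x) := by
  have ha := (H.smooth_coeff.contMDiffAt (H.isOpen.mem_nhds hx)).mdifferentiableAt (by simp)
  have hd {q : M → ℝ} (hq : ContMDiffOn 𝓘(ℝ, E) 𝓘(ℝ, ℝ) ∞ q s) {y : M} (hy : y ∈ s) :
      MDiffAt q y := (hq.contMDiffAt (H.isOpen.mem_nhds hy)).mdifferentiableAt (by simp)
  have hcoef {p q p' q' : ℝ} (h : p • U x + q • N x = p' • U x + q' • N x) : p = p' ∧ q = q' := by
    have h1 := congrArg (fun v ↦ g.inner x v (U x)) h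
    have h2 := congrArg (fun v ↦ g.inner x v (N x)) h
    simp [H.inner_left_right x hx, g.symm x (N x) (U x), H.inner_left x hx, H.inner_right x hx,
      H.ne_zero] at h1 h2
    exact ⟨h1, h2⟩
  obtain ⟨X₁, X₂, hX₁, hX₂, hXs⟩ := H.exists_smooth_coeff hX
  obtain ⟨Y₁, Y₂, hY₁, hY₂, hYs⟩ := H.exists_smooth_coeff hY
  obtain ⟨Z₁, Z₂, hZ₁, hZ₂, hZs⟩ := H.exists_smooth_coeff hZ
  -- By uniqueness of frame coefficients, the given numbers are the values at `x` of the smooth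
  -- coefficient functions.
  obtain ⟨rfl, rfl⟩ := hcoef (hXx.symm.trans (hXs x hx))
  obtain ⟨rfl, rfl⟩ := hcoef (hYx.symm.trans (hYs x hx))
  obtain ⟨rfl, rfl⟩ := hcoef (hZx.symm.trans (hZs x hx))
  have hev {W : VField E M} {W₁ W₂ : M → ℝ} (hW : ∀ y ∈ s, W y = W₁ y • U y + W₂ y • N y) {y : M}
      (hy : y ∈ s) : W =ᶠ[𝓝 y] W₁ • U + W₂ • N := by
    filter_upwards [H.isOpen.mem_nhds hy] with y hy using hW y hy
  have hder {W : VField E M} {p : M → ℝ} (hW : SmoothOn W s)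
      (hp : ContMDiffOn 𝓘(ℝ, E) 𝓘(ℝ, ℝ) ∞ p s) := hd
    (contMDiffOn_mvfderiv g H.isOpen H.smooth_right H.inner_right hW hp) hx
  have hcov {W : VField E M} {W₁ W₂ : M → ℝ} (hW : ∀ y ∈ s, W y = W₁ y • U y + W₂ y • N y) :
      (fun y ↦ leviCivita g Z y (W y)) =ᶠ[𝓝 x]
        ((fun y ↦ mvfderiv 𝓘(ℝ, E) Z₁ y (W y) + a y * W₁ y * Z₂ y) • U +
          (fun y ↦ mvfderiv 𝓘(ℝ, E) Z₂ y (W y) - r * a y * W₁ y * Z₁ y) • N : VField E M) := by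
    filter_upwards [H.isOpen.mem_nhds hx] with y hy
    exact H.leviCivita_apply hy (hd hZ₁ hy) (hd hZ₂ hy) (hev hZs hy) (hW y hy)
  have m1 {W : VField E M} {W₁ : M → ℝ} (hW : SmoothOn W s) (hW₁ : MDiffAt W₁ x) :
      MDiffAt (fun y ↦ mvfderiv 𝓘(ℝ, E) Z₁ y (W y) + a y * W₁ y * Z₂ y) x :=
    (hder hW hZ₁).add ((ha.mul hW₁).mul (hd hZ₂ hx))
  have m2 {W : VField E M} {W₁ : M → ℝ} (hW : SmoothOn W s) (hW₁ : MDiffAt W₁ x) :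
      MDiffAt (fun y ↦ mvfderiv 𝓘(ℝ, E) Z₂ y (W y) - r * a y * W₁ y * Z₁ y) x :=
    (hder hW hZ₂).sub (((mdifferentiableAt_const.mul ha).mul hW₁).mul (hd hZ₁ hx))
  have d1 {W : VField E M} {W₁ : M → ℝ} (hW : SmoothOn W s) (hW₁ : MDiffAt W₁ x)
      (v : TangentSpace 𝓘(ℝ, E) x) :
      mvfderiv 𝓘(ℝ, E) (fun y ↦ mvfderiv 𝓘(ℝ, E) Z₁ y (W y) + a y * W₁ y * Z₂ y) x v =
        mvfderiv 𝓘(ℝ, E) (fun y ↦ mvfderiv 𝓘(ℝ, E) Z₁ y (W y)) x v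
          + (mvfderiv 𝓘(ℝ, E) a x v * W₁ x * Z₂ x + a x * mvfderiv 𝓘(ℝ, E) W₁ x v * Z₂ x
            + a x * W₁ x * mvfderiv 𝓘(ℝ, E) Z₂ x v) := by
    have h1 : MDiffAt (fun y ↦ a y * W₁ y) x := ha.mul hW₁
    have h2 : MDiffAt (fun y ↦ a y * W₁ y * Z₂ y) x := h1.mul (hd hZ₂ hx)
    rw [mvfderiv_fun_add (hder hW hZ₁) h2, mvfderiv_fun_mul h1 (hd hZ₂ hx),
      mvfderiv_fun_mul ha hW₁]
    simp; ring
  have d2 {W : VField E M} {W₁ : M → ℝ} (hW : SmoothOn W s) (hW₁ : MDiffAt W₁ x)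
      (v : TangentSpace 𝓘(ℝ, E) x) :
      mvfderiv 𝓘(ℝ, E) (fun y ↦ mvfderiv 𝓘(ℝ, E) Z₂ y (W y) - r * a y * W₁ y * Z₁ y) x v =
        mvfderiv 𝓘(ℝ, E) (fun y ↦ mvfderiv 𝓘(ℝ, E) Z₂ y (W y)) x v
          - r * (mvfderiv 𝓘(ℝ, E) a x v * W₁ x * Z₁ x + a x * mvfderiv 𝓘(ℝ, E) W₁ x v * Z₁ x
            + a x * W₁ x * mvfderiv 𝓘(ℝ, E) Z₁ x v) := by
    have hc : MDiffAt (fun _ : M ↦ r) x := mdifferentiableAt_const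
    have h0 : MDiffAt (fun y ↦ r * a y) x := hc.mul ha
    have h1 : MDiffAt (fun y ↦ r * a y * W₁ y) x := h0.mul hW₁
    have h2 : MDiffAt (fun y ↦ r * a y * W₁ y * Z₁ y) x := h1.mul (hd hZ₁ hx)
    rw [mvfderiv_fun_sub (hder hW hZ₂) h2, mvfderiv_fun_mul h1 (hd hZ₁ hx),
      mvfderiv_fun_mul h0 hW₁, mvfderiv_fun_mul hc ha, mvfderiv_const]
    simp; ring
  obtain ⟨q, hq⟩ := H.mlieBracket_coeff hx (hd hX₁ hx) (hd hX₂ hx) (hd hY₁ hx) (hd hY₂ hx)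
    (hev hXs hx) (hev hYs hx)
  -- This removes all second derivatives of the coefficients of `Z`, which enter the curvature only
  -- as `X(Y p) - Y(X p) - [X, Y] p`.
  have hb {p : M → ℝ} (hp : ContMDiffOn 𝓘(ℝ, E) 𝓘(ℝ, ℝ) ∞ p s) :=
    mvfderiv_mlieBracket g H.isOpen H.smooth_right H.inner_right hX hY hp hx
  -- In `X(a) Y₁ - Y(a) X₁` the derivative `U a` cancels, leaving `-(N a)` times the determinant `X₁
  -- Y₂ - X₂ Y₁`. The term in `a ^ 2` comes from the bracket.
  have haX : mvfderiv 𝓘(ℝ, E) a x (X x) =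
      X₁ x * mvfderiv 𝓘(ℝ, E) a x (U x) + X₂ x * mvfderiv 𝓘(ℝ, E) a x (N x) := by
    rw [hXs x hx, map_add, map_smul, map_smul]; rfl
  have haY : mvfderiv 𝓘(ℝ, E) a x (Y x) =
      Y₁ x * mvfderiv 𝓘(ℝ, E) a x (U x) + Y₂ x * mvfderiv 𝓘(ℝ, E) a x (N x) := by
    rw [hYs x hx, map_add, map_smul, map_smul]; rfl
  rw [curvature, H.leviCivita_apply hx (m1 hY (hd hY₁ hx)) (m2 hY (hd hY₁ hx)) (hcov hYs) hXx,
    H.leviCivita_apply hx (m1 hX (hd hX₁ hx)) (m2 hX (hd hX₁ hx)) (hcov hXs) hYx,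
    H.leviCivita_apply hx (hd hZ₁ hx) (hd hZ₂ hx) (hev hZs hx) hq, hb hZ₁, hb hZ₂,
    d1 hY (hd hY₁ hx), d1 hX (hd hX₁ hx), d2 hY (hd hY₁ hx), d2 hX (hd hX₁ hx), haX, haY]
  module

end IsAdaptedFrame

/-! ### Frames adapted to a foliation of a surface -/

/-- The unit vector field in the direction of `X`. -/
def normalize (g : Metric E M) (X : VField E M) : VField E M :=
  fun y ↦ (√(g.inner y (X y) (X y)))⁻¹ • X y

theorem SmoothOn.normalize {s : Set M} {X : VField E M} (hX : SmoothOn X s) (g : Metric E M)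
    (h0 : ∀ y ∈ s, X y ≠ 0) : SmoothOn (normalize g X) s := by
  refine SmoothOn.smul hX fun y hy ↦ ?_
  have hpos := g.pos y (X y) (h0 y hy)
  exact ContDiffAt.comp_contMDiffWithinAt (g := fun t : ℝ ↦ (√t)⁻¹)
    ((Real.contDiffAt_sqrt hpos.ne').inv (Real.sqrt_pos.2 hpos).ne') (hX.inner hX g y hy)

theorem inner_normalize (g : Metric E M) {X : VField E M} {y : M} (h0 : X y ≠ 0) :
    g.inner y (normalize g X y) (normalize g X y) = 1 := by
  have hpos := g.pos y (X y) h0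
  have h := Real.sq_sqrt hpos.le
  have h' := (Real.sqrt_pos.2 hpos).ne'
  simp only [normalize, map_smul, smul_apply, smul_eq_mul]
  field_simp
  exact h.symm

theorem sqrt_smul_normalize (g : Metric E M) {X : VField E M} {y : M} (h0 : X y ≠ 0) :
    √(g.inner y (X y) (X y)) • normalize g X y = X y :=
  smul_inv_smul₀ (Real.sqrt_pos.2 (g.pos y (X y) h0)).ne' _

/-- A vector field that is constant in a chart of the maximal atlas. -/
theorem exists_constant_in_chart [FiniteDimensional ℝ E] {φ : OpenPartialHomeomorph M E}
    (hφ : φ ∈ IsManifold.maximalAtlas 𝓘(ℝ, E) ∞ M) (l : E) :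
    ∃ X : VField E M, SmoothOn X φ.source ∧
      ∀ y ∈ φ.source, mfderiv 𝓘(ℝ, E) 𝓘(ℝ, E) φ y (X y) = l := by
  have hφd : φ.MDifferentiable 𝓘(ℝ, E) 𝓘(ℝ, E) :=
    ⟨(contMDiffOn_of_mem_maximalAtlas hφ).mdifferentiableOn (by simp),
      (contMDiffOn_symm_of_mem_maximalAtlas hφ).mdifferentiableOn (by simp)⟩
  have hinv {y : M} (hy : y ∈ φ.source) : (mfderiv 𝓘(ℝ, E) 𝓘(ℝ, E) φ y).IsInvertible :=
    ⟨hφd.mfderiv hy, rfl⟩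
  -- The constant field `l` on the model space, pulled back along the chart.
  refine ⟨VectorField.mpullback 𝓘(ℝ, E) 𝓘(ℝ, E) φ fun _ ↦ l, fun y hy ↦ ?_, fun y hy ↦ ?_⟩
  · have hφs : ContMDiffAt 𝓘(ℝ, E) 𝓘(ℝ, E) ∞ φ y :=
      (contMDiffOn_of_mem_maximalAtlas hφ).contMDiffAt (φ.open_source.mem_nhds hy)
    refine (ContMDiffAt.mpullback_vectorField_preimage (n := ∞) ?_ hφs (hinv hy)
      (by simp)).contMDiffWithinAt
    exact contMDiffAt_vectorSpace_iff_contDiffAt.2 contDiffAt_const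
  · exact (hinv hy).self_apply_inverse _

/-- Gram–Schmidt applied to two fields that are constant in a flat chart: one with value `l`
spanning the plaque direction `L`, the other with value `m` outside `L`. -/
theorem Foliation.exists_orthonormal_frame [FiniteDimensional ℝ E] (hE : Module.finrank ℝ E = 2)
    (F : Foliation E M 1) (g : Metric E M) (x : M) :
    ∃ (s : Set M) (U N : VField E M), IsOpen s ∧ x ∈ s ∧ SmoothOn U s ∧ SmoothOn N s ∧
      (∀ y ∈ s, g.inner y (U y) (U y) = 1) ∧ (∀ y ∈ s, g.inner y (N y) (N y) = 1) ∧
      (∀ y ∈ s, U y ∈ F.tangent y) ∧ (∀ y ∈ s, N y ∈ F.normal g y) ∧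
      ∀ y ∈ s, ∀ v : TangentSpace 𝓘(ℝ, E) y, ∃ p q : ℝ, v = p • U y + q • N y := by
  obtain ⟨φ, hφ, hx, L, hL1, hL⟩ := F.exists_flat_chart x
  obtain ⟨⟨l, hlL⟩, hl0, hl⟩ := finrank_eq_one_iff'.1 hL1
  have hl0' : l ≠ 0 := fun h ↦ hl0 (Subtype.ext h)
  have hlt : ∃ m : E, m ∉ L := by
    by_contra! h
    have : L = ⊤ := by ext; simp [h]
    rw [this, finrank_top, hE] at hL1
    norm_num at hL1
  obtain ⟨m, hm⟩ := hlt
  have hli : LinearIndependent ℝ ![l, m] := by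
    refine (LinearIndependent.pair_iff' hl0').2 fun c hc ↦ hm ?_
    rw [← hc]; exact L.smul_mem c hlL
  have hspan : ∀ e : E, ∃ p q : ℝ, e = p • l + q • m := by
    intro e
    have h1 := hli.span_eq_top_of_card_eq_finrank' (by simp [hE])
    have h2 : e ∈ Submodule.span ℝ (Set.range ![l, m]) := h1 ▸ Submodule.mem_top
    simp only [Matrix.range_cons, Matrix.range_empty, Set.union_empty,
      Set.singleton_union] at h2
    obtain ⟨p, q, h⟩ := Submodule.mem_span_pair.1 h2
    exact ⟨p, q, h.symm⟩
  obtain ⟨U₀, hU₀, hU₀l⟩ := exists_constant_in_chart hφ l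
  obtain ⟨N₀, hN₀, hN₀m⟩ := exists_constant_in_chart hφ m
  have hφd : φ.MDifferentiable 𝓘(ℝ, E) 𝓘(ℝ, E) :=
    ⟨(contMDiffOn_of_mem_maximalAtlas hφ).mdifferentiableOn (by simp),
      (contMDiffOn_symm_of_mem_maximalAtlas hφ).mdifferentiableOn (by simp)⟩
  have hinj : ∀ y ∈ φ.source, Function.Injective (mfderiv 𝓘(ℝ, E) 𝓘(ℝ, E) φ y) :=
    fun y hy ↦ (hφd.mfderiv_bijective hy).1
  have hU₀0 : ∀ y ∈ φ.source, U₀ y ≠ 0 := fun y hy h ↦ hl0' <| by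
    rw [← hU₀l y hy, h, map_zero]; rfl
  set U := normalize g U₀ with hU
  have hUs : SmoothOn U φ.source := hU₀.normalize g hU₀0
  have hUU : ∀ y ∈ φ.source, g.inner y (U y) (U y) = 1 := fun y hy ↦ inner_normalize g (hU₀0 y hy)
  have hUt : ∀ y ∈ φ.source, U y ∈ F.tangent y := fun y hy ↦ by
    refine Submodule.smul_mem _ _ ((hL y hy _).2 ?_)
    rw [hU₀l y hy]; exact hlL
  set N₁ : VField E M := N₀ - (fun y ↦ g.inner y (N₀ y) (U y)) • U with hN₁
  have hN₁s : SmoothOn N₁ φ.source := hN₀.sub (hUs.smul (hN₀.inner hUs g))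
  -- If the orthogonal part of `N₀` vanished, `N₀` would be tangent to the leaf, forcing `m ∈ L`.
  have hN₁0 : ∀ y ∈ φ.source, N₁ y ≠ 0 := fun y hy h ↦ hm <| by
    have h1 : N₀ y = g.inner y (N₀ y) (U y) • U y := sub_eq_zero.1 h
    rw [← hN₀m y hy]
    refine (hL y hy _).1 ?_
    rw [h1]
    exact Submodule.smul_mem _ _ (hUt y hy)
  have hN₁U : ∀ y ∈ φ.source, g.inner y (U y) (N₁ y) = 0 := fun y hy ↦ by
    simp [hN₁, hUU y hy, g.symm y (U y) (N₀ y)]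
  refine ⟨φ.source, U, normalize g N₁, φ.open_source, hx, hUs, hN₁s.normalize g hN₁0, hUU,
    fun y hy ↦ inner_normalize g (hN₁0 y hy), hUt, fun y hy ↦ Submodule.smul_mem _ _ ?_, ?_⟩
  · intro v hv
    -- As `L` is the line through `l`, every tangent vector of the leaf is a multiple of `U₀`, so
    -- orthogonality to `U` suffices.
    obtain ⟨c, hc⟩ := hl ⟨_, (hL y hy v).1 hv⟩
    have hc' : c • l = mfderiv 𝓘(ℝ, E) 𝓘(ℝ, E) φ y v := congrArg Subtype.val hc
    have h1 : v = c • U₀ y := hinj y hy (by rw [map_smul, hU₀l y hy]; exact hc'.symm)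
    rw [h1, ← sqrt_smul_normalize g (hU₀0 y hy)]
    simp [← hU, hN₁U y hy]
  · intro y hy v
    obtain ⟨p, q, hpq⟩ := hspan (mfderiv 𝓘(ℝ, E) 𝓘(ℝ, E) φ y v)
    have h1 : v = p • U₀ y + q • N₀ y := hinj y hy <| by
      rw [map_add, map_smul, map_smul, hU₀l y hy, hN₀m y hy]; exact hpq
    have h2 : N₀ y = N₁ y + g.inner y (N₀ y) (U y) • U y := by simp [hN₁]
    have h3 := sqrt_smul_normalize g (hU₀0 y hy)
    have h4 := sqrt_smul_normalize g (hN₁0 y hy)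
    refine ⟨p * √(g.inner y (U₀ y) (U₀ y)) + q * g.inner y (N₀ y) (U y),
      q * √(g.inner y (N₁ y) (N₁ y)), ?_⟩
    rw [← hU] at h3
    rw [h1, h2, add_smul, mul_smul, mul_smul, mul_smul, h3, h4, ← h2]
    nth_rw 1 [h2]
    module

/-- Near every point of a surface with a Riemannian foliation there is a frame that is adapted to
the metric and to all its warpings by a constant. -/
theorem Foliation.IsRiemannian.exists_adaptedFrame [FiniteDimensional ℝ E]
    (hE : Module.finrank ℝ E = 2) {F : Foliation E M 1} {g : Metric E M} (hF : F.IsRiemannian g)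
    (f : WarpingFunction F) {c : ℝ} (hf : ∀ x, f.toFun x = c) (x : M) :
    ∃ (s : Set M) (U N : VField E M) (a : M → ℝ), x ∈ s ∧ IsAdaptedFrame g s U N a 1 ∧
      IsAdaptedFrame (warpedMetric g f) s U N a (c ^ 2) := by
  obtain ⟨s, U, N, hs, hx, hU, hN, hUU, hNN, hUt, hNn, hsp⟩ := F.exists_orthonormal_frame hE g x
  have hUN : ∀ y ∈ s, g.inner y (U y) (N y) = 0 := fun y hy ↦ hNn y hy _ (hUt y hy)
  have ha := (hU.mlieBracket hN hs).inner hU g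
  have hc : c ≠ 0 := hf x ▸ (f.pos x).ne'
  have hb : ∀ y ∈ s, VectorField.mlieBracket 𝓘(ℝ, E) U N y =
      g.inner y (VectorField.mlieBracket 𝓘(ℝ, E) U N y) (U y) • U y := by
    intro y hy
    -- With both normal fields equal to `N`, of constant length, the Lie derivative reduces to `-2
    -- g([U, N], N)`, so the bracket has no normal component.
    have h := hF s hs U N N hU hN hN hUt hNn hNn y hy
    rw [lieDerivMetric, mvfderiv_eq_zero_of_eqOn_const hs hNN hy, g.symm y (N y), zero_apply] at h
    obtain ⟨p, q, hpq⟩ := hsp y hy (VectorField.mlieBracket 𝓘(ℝ, E) U N y)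
    rw [hpq] at h ⊢
    simp [hUN y hy, hNN y hy] at h
    have hq : q = 0 := by linarith
    simp [hUU y hy, hq]
  -- The coefficient is `a = g([U, N], U)`. It serves both metrics, since the bracket relation `hb`
  -- is independent of the metric; only the inner products of the frame are recomputed.
  refine ⟨s, U, N, _, hx, ⟨hs, hU, hN, ha, one_ne_zero, hUU, hNN, hUN, hb, hsp⟩,
    ⟨hs, hU, hN, ha, pow_ne_zero 2 hc, fun y hy ↦ ?_, fun y hy ↦ ?_, fun y hy ↦ ?_, hb, hsp⟩⟩
  · exact (warpedInner_tangent g f y (hUt y hy) (hUt y hy)).trans (by rw [hUU y hy, hf, mul_one])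
  · exact (warpedInner_normal g f y (hNn y hy)).trans (hNN y hy)
  · exact (warpedInner_normal g f y (hNn y hy)).trans (hUN y hy)

namespace IsAdaptedFrame

variable [FiniteDimensional ℝ E] {g : Metric E M} {s : Set M} {U N : VField E M} {a : M → ℝ}
  {r : ℝ} {x : M}

/-- The numerator of the sectional curvature in an adapted frame. -/
theorem inner_curvature_extend (H : IsAdaptedFrame g s U N a r) (hx : x ∈ s)
    {v w : TangentSpace 𝓘(ℝ, E) x} {v₁ v₂ w₁ w₂ : ℝ} (hv : v = v₁ • U x + v₂ • N x)
    (hw : w = w₁ • U x + w₂ • N x) :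
    g.inner x (curvature g (FiberBundle.extend E v) (FiberBundle.extend E w)
      (FiberBundle.extend E w) x) v =
        -(mvfderiv 𝓘(ℝ, E) a x (N x) + a x ^ 2) * (r * (v₁ * w₂ - v₂ * w₁) ^ 2) := by
  obtain ⟨t, ht, hxt, hvt⟩ := exists_smoothOn_extend v
  obtain ⟨t', ht', hxt', hwt⟩ := exists_smoothOn_extend w
  -- Shrink to an open set where the frame and both extensions are smooth.
  have H' := H.mono ((H.isOpen.inter ht).inter ht') fun y hy ↦ hy.1.1
  have hw' := hwt.mono (t := s ∩ t ∩ t') fun y hy ↦ hy.2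
  rw [H'.curvature_eq ⟨⟨hx, hxt⟩, hxt'⟩ (hvt.mono fun y hy ↦ hy.1.2) hw' hw'
    ((FiberBundle.extend_apply_self E v).trans hv) ((FiberBundle.extend_apply_self E w).trans hw)
    ((FiberBundle.extend_apply_self E w).trans hw), hv]
  have hNU : g.inner x (N x) (U x) = 0 := (g.symm x _ _).trans (H.inner_left_right x hx)
  simp only [map_add, map_smul, map_sub, smul_apply, sub_apply, smul_eq_mul,
    H.inner_left x hx, H.inner_right x hx, H.inner_left_right x hx, hNU]
  ring

end IsAdaptedFrame
end WarpedFoliation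
end

/-! ### Comparison of the two metrics -/

theorem mainTheorem7 {M : Type*} [TopologicalSpace M] [T2Space M] [CompactSpace M]
    [ChartedSpace (EuclideanSpace ℝ (Fin 2)) M]
    [IsManifold 𝓘(ℝ, EuclideanSpace ℝ (Fin 2)) ∞ M]
    (g : WarpedFoliation.Metric (EuclideanSpace ℝ (Fin 2)) M)
    (hg : WarpedFoliation.HasConstantSectionalCurvature g 0)
    (F : WarpedFoliation.Foliation (EuclideanSpace ℝ (Fin 2)) M 1)
    (hF : F.IsRiemannian g)
    (f : WarpedFoliation.WarpingFunction F)
    (hf : ∃ c : ℝ, ∀ x, f.toFun x = c) :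
    WarpedFoliation.HasConstantSectionalCurvature (WarpedFoliation.warpedMetric g f) 0 := by
  obtain ⟨c, hc⟩ := hf
  intro x v w _
  obtain ⟨s, U, N, a, hx, H, H'⟩ := hF.exists_adaptedFrame (by simp) f hc x
  -- Flatness of `g` is tested on the plane spanned by the orthonormal pair `U x`, `N x`, where the
  -- denominator is `1`.
  have hflat : mvfderiv 𝓘(ℝ, EuclideanSpace ℝ (Fin 2)) a x (N x) + a x ^ 2 = 0 := by
    have hli : LinearIndependent ℝ ![U x, N x] := by
      refine LinearIndependent.pair_iff.2 fun p q h ↦ ?_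
      have hNU : g.inner x (N x) (U x) = 0 := (g.symm x _ _).trans (H.inner_left_right x hx)
      have h1 := congrArg (fun v ↦ g.inner x v (U x)) h
      have h2 := congrArg (fun v ↦ g.inner x v (N x)) h
      simp [H.inner_left x hx, H.inner_right x hx, H.inner_left_right x hx, hNU] at h1 h2
      exact ⟨h1, h2⟩
    have h := hg x (U x) (N x) hli
    rw [WarpedFoliation.sectionalCurvature, H.inner_curvature_extend (v₁ := 1) (v₂ := 0) (w₁ := 0)
      (w₂ := 1) hx (by simp) (by simp), H.inner_left x hx, H.inner_right x hx,
      H.inner_left_right x hx] at h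
    norm_num at h
    linarith
  obtain ⟨v₁, v₂, hv⟩ := H.exists_eq x hx v
  obtain ⟨w₁, w₂, hw⟩ := H.exists_eq x hx w
  -- The frame formula for `g_f` has the same factor `N a + a ^ 2`, so its numerator vanishes for
  -- every pair of vectors.
  rw [WarpedFoliation.sectionalCurvature, H'.inner_curvature_extend hx hv hw, hflat]
  simp
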